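/- Let $\Omega\subset\mathbb R^2$ be a bounded domain with $C^\infty$ boundary, with outward unit normal $\nu$ on $\partial\Omega$, and let $\Gamma(x)=\frac1{2\pi}\log|x|$. Let $N\ge 0$ be an integer and, for each multiindex $\alpha=(\alpha_1,\alpha_2)$ of nonnegative integers with $|\alpha|=\alpha_1+\alpha_2\le N$, let $N_\alpha\ge 0$ be an integer and let $b_j^\alpha\in\mathbb R$ and $x_j^\alpha\in\Omega$ $(1\le j\le N_\alpha)$ be given. Let $u_0$ be harmonic in a neighbourhood of $\overline\Omega$ and put $$u(x)=u_0(x)+\sum_{|\alpha|\le N}\sum_{j=1}^{N_\alpha}b_j^\alpha\,D^\alpha\Gamma(x-x_j^\alpha),\qquad D^\alpha=\partial_1^{\alpha_1}\partial_2^{\alpha_2}.$$ Let $p=|Du|^2$ and $q=\partial p/\partial\nu$, and assume that $p>0$ on $\partial\Omega$. Then $q/(2p)$ is integrable on $\partial\Omega$ with respect to arc length $\tau$, and $$-\frac1{2\pi}\int_{\partial\Omega}\frac q{2p}\,d\tau\le\sum_{|\alpha|\le N}(|\alpha|+1)N_\alpha.$$ Moreover, equality holds if all the coefficients $b_j^\alpha$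 are nonzero, the points $x_j^\alpha$ (for all $\alpha$ and $j$) are pairwise distinct, and $p$ does not vanish in $\Omega\setminus\{x_j^\alpha\}$. -/

import Mathlib

open MeasureTheory

/-- The Euclidean plane. -/
abbrev Plane : Type := EuclideanSpace ℝ (Fin 2)

/-- The partial derivative `∂f/∂xᵢ`. -/
noncomputable def partialDeriv (i : Fin 2) (f : Plane → ℝ) : Plane → ℝ :=
  fun x => fderiv ℝ f x (EuclideanSpace.single i 1)

/-- The derivative `D^α f = ∂₁^{α₁} ∂₂^{α₂} f` for a multiindex `α`. -/
noncomputable def multiDeriv (α : Fin 2 → ℕ) (f : Plane → ℝ) : Plane → ℝ :=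
  (partialDeriv 0)^[α 0] ((partialDeriv 1)^[α 1] f)

/-- The fundamental solution `Γ(x) = (1/2π) log |x|` of the Laplace equation in the plane. -/
noncomputable def fundSol (x : Plane) : ℝ := (1 / (2 * Real.pi)) * Real.log ‖x‖

/-- The order `|α| = α₁ + α₂` of a multiindex. -/
def multiOrder (α : Fin 2 → ℕ) : ℕ := α 0 + α 1

/-- The finite set of all multiindices `α` with `|α| ≤ N`. -/
def multiIndices (N : ℕ) : Finset (Fin 2 → ℕ) :=
  Finset.filter (fun α => multiOrder α ≤ N) (Fintype.piFinset fun _ => Finset.range (N + 1))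

theorem mem_multiIndices {N : ℕ} {α : Fin 2 → ℕ} :
    α ∈ multiIndices N ↔ multiOrder α ≤ N := by
  rw [multiIndices, Finset.mem_filter, Fintype.mem_piFinset]
  simp only [Finset.mem_range, Fin.forall_fin_two, multiOrder]
  omega

/-- `φ` is a smooth defining function of `Ω` near the boundary point `x`: `φ` has a nonzero
gradient at `x`, vanishes there, and `Ω` is the set `{φ < 0}` in a neighbourhood of `x`. -/
structure IsDefiningFunctionAt (Ω : Set Plane) (x : Plane) (φ : Plane → ℝ) : Prop where
  smooth : ContDiff ℝ (⊤ : ℕ∞) φ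
  eq_zero : φ x = 0
  gradient_ne_zero : gradient φ x ≠ 0
  mem_iff : ∃ r > 0, ∀ y ∈ Metric.ball x r, y ∈ Ω ↔ φ y < 0

/-- A bounded domain (nonempty connected open set) with smooth (`C^∞`) boundary, lying locally
on one side of its boundary. It need not be simply connected. -/
structure IsSmoothBoundedDomain (Ω : Set Plane) : Prop where
  isOpen : IsOpen Ω
  isConnected : IsConnected Ω
  isBounded : Bornology.IsBounded Ω
  smooth_boundary : ∀ x ∈ frontier Ω, ∃ φ : Plane → ℝ, IsDefiningFunctionAt Ω x φ

/-- `n` is the outward unit normal of `Ω` at the boundary point `x`. -/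
def IsOutwardUnitNormalAt (Ω : Set Plane) (x n : Plane) : Prop :=
  ∃ φ : Plane → ℝ, IsDefiningFunctionAt Ω x φ ∧ n = ‖gradient φ x‖⁻¹ • gradient φ x

/-! Identify the plane with `ℂ` and let `f = ∂₁u - i ∂₂u`. Harmonicity of `u₀` makes its
contribution to `f` analytic near the closure of `Ω`. The complex gradient of `Γ` is `1 / (2π z)`,
and each further derivative raises the pole order by one, so a source of type `α` contributes a
constant multiple of `(z - a)⁻ᵏ` with `k = |α| + 1`. Since `p = |f|²`, on the boundary `q / (2p) =
Re (f'/f · ν)`. The integral is therefore `2π` times the number of zeros minus the number of poles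
of `f`, and the number of poles is at most `∑ (|α| + 1) N_α`.

Zeros are never actually counted. Multiplying `f` by all the factors `(z - a_j) ^ k_j` gives an
analytic `F` (`clearedPolarParts`), and each simple factor accounts for exactly `2π` of boundary
flux (`integral_frontier_inv_sub`). It remains to see that `∫ Re (F'/F · ν) ≥ 0`. For this `F'/F` is
replaced by `conj F · F' / (|F|² + ε)`, which is smooth across the zeros of `F` and has nonnegative
`∂̄`-derivative; Gauss–Green gives the sign, and `ε → 0` gives `integral_frontier_logDeriv_nonneg`.
In the equality case `F` has no zeros on the closure, `F'/F` is analytic there, and its flux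
vanishes.

The analytic input is Gauss–Green for a smooth bounded domain with boundary measure `μH[1]`
(`gauss_green`): the boundary is locally a graph, its arc length has density `‖γ'‖`, and cut-offs
globalize the local formula. -/

/-! ### Arc length: one-dimensional Hausdorff measure on an injective `C¹` curve. -/

open Set Filter Topology Metric in
theorem eventually_hausdorffMeasure_image_closedBall_le {E : Type*} [NormedAddCommGroup E]
    [NormedSpace ℝ E] [MeasurableSpace E] [BorelSpace E] {γ : ℝ → E} {γ' : E} {s : ℝ}
    (h : HasStrictDerivAt γ γ' s) {K : NNReal} (hK : ‖γ'‖₊ < K) :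
    ∀ᶠ r in 𝓝[>] (0 : ℝ),
      Measure.hausdorffMeasure 1 (γ '' closedBall s r) ≤ K * volume (closedBall s r) := by
  obtain ⟨t, ht, hlip⟩ := h.hasStrictFDerivAt.exists_lipschitzOnWith_of_nnnorm_lt K
    (by simpa using hK)
  obtain ⟨r, hr, hrt⟩ := Metric.nhds_basis_closedBall.mem_iff.1 ht
  filter_upwards [Ioo_mem_nhdsGT hr] with ρ hρ
  have := (hlip.mono ((closedBall_subset_closedBall hρ.2.le).trans hrt)).hausdorffMeasure_image_le
    (d := 1) zero_le_one
  simpa [hausdorffMeasure_real] using this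

-- Strict differentiability makes `γ` expand distances by at least `K` on a small interval, so its
-- inverse on the image is `K⁻¹`-Lipschitz and the Lipschitz bound for Hausdorff measure applies to
-- the inverse.
open Set Filter Topology Metric in
theorem eventually_le_hausdorffMeasure_image_closedBall {E : Type*} [NormedAddCommGroup E]
    [NormedSpace ℝ E] [MeasurableSpace E] [BorelSpace E] {γ : ℝ → E} {γ' : E} {s : ℝ}
    (h : HasStrictDerivAt γ γ' s) {K : NNReal} (hK : K < ‖γ'‖₊) :
    ∀ᶠ r in 𝓝[>] (0 : ℝ),
      K * volume (closedBall s r) ≤ Measure.hausdorffMeasure 1 (γ '' closedBall s r) := by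
  rcases eq_or_ne K 0 with rfl | hK0
  · simp
  have hε : 0 < ‖γ'‖ - K := sub_pos.2 (by exact_mod_cast hK)
  have h1 := (hasStrictFDerivAt_iff_isLittleO.1 h.hasStrictFDerivAt).def hε
  obtain ⟨r, hr, hrt⟩ := Metric.nhds_basis_closedBall.mem_iff.1 h1
  filter_upwards [Ioo_mem_nhdsGT hr] with ρ hρ
  have hanti : ∀ a ∈ closedBall s ρ, ∀ b ∈ closedBall s ρ,
      K * ‖a - b‖ ≤ ‖γ a - γ b‖ := by
    intro a ha b hb
    have hab : (a, b) ∈ closedBall (s, s) r := by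
      simp only [mem_closedBall, Prod.dist_eq, max_le_iff] at ha hb ⊢
      exact ⟨ha.trans hρ.2.le, hb.trans hρ.2.le⟩
    have h2 := hrt hab
    simp only [mem_ofPred_eq] at h2
    rw [norm_sub_rev] at h2
    have h3 : ‖(ContinuousLinearMap.toSpanSingleton ℝ γ') (a - b)‖ = ‖a - b‖ * ‖γ'‖ := by
      simp [norm_smul]
    have h4 := norm_sub_norm_le ((ContinuousLinearMap.toSpanSingleton ℝ γ') (a - b)) (γ a - γ b)
    have h5 := h4.trans h2
    rw [h3] at h5
    nlinarith
  have hinj : InjOn γ (closedBall s ρ) := by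
    intro a ha b hb hab
    have := hanti a ha b hb
    rw [hab, sub_self, norm_zero] at this
    have hKp : (0 : ℝ) < K := by exact_mod_cast pos_iff_ne_zero.2 hK0
    have : ‖a - b‖ ≤ 0 := by
      by_contra hcon
      push Not at hcon
      nlinarith [mul_pos hKp hcon]
    exact sub_eq_zero.1 (norm_le_zero_iff.1 this)
  have hlip : LipschitzOnWith K⁻¹ (Function.invFunOn γ (closedBall s ρ))
      (γ '' closedBall s ρ) := by
    refine LipschitzOnWith.of_dist_le_mul ?_
    rintro _ ⟨a, ha, rfl⟩ _ ⟨b, hb, rfl⟩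
    rw [hinj.leftInvOn_invFunOn ha, hinj.leftInvOn_invFunOn hb, dist_eq_norm, dist_eq_norm,
      NNReal.coe_inv, inv_mul_eq_div, le_div_iff₀ (by exact_mod_cast pos_iff_ne_zero.2 hK0), mul_comm]
    exact hanti a ha b hb
  have := hlip.hausdorffMeasure_image_le (d := 1) zero_le_one
  rw [hinj.leftInvOn_invFunOn.image_image, hausdorffMeasure_real] at this
  simp only [ENNReal.rpow_one] at this
  calc (K : ENNReal) * volume (closedBall s ρ)
      ≤ K * (((K⁻¹ : NNReal) : ENNReal) * Measure.hausdorffMeasure 1 (γ '' closedBall s ρ)) := by gcongr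
    _ = _ := by
      rw [← mul_assoc, ← ENNReal.coe_mul, mul_inv_cancel₀ hK0, ENNReal.coe_one, one_mul]

open Set Filter Topology Metric in
/-- The arc length formula for an injective `C¹` curve. -/
theorem comap_hausdorffMeasure_eq_withDensity {E : Type*} [NormedAddCommGroup E]
    [NormedSpace ℝ E] [MeasurableSpace E] [BorelSpace E] {γ : ℝ → E}
    (hγ : ContDiff ℝ 1 γ) (hinj : Function.Injective γ) :
    Measure.comap γ (Measure.hausdorffMeasure 1) =
      (volume : Measure ℝ).withDensity (fun s => (‖deriv γ s‖₊ : ENNReal)) := by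
  have hemb : MeasurableEmbedding γ := hγ.continuous.measurableEmbedding hinj
  have hstrict : ∀ s, HasStrictDerivAt γ (deriv γ s) s := fun s =>
    hγ.contDiffAt.hasStrictDerivAt one_ne_zero
  set μ := Measure.comap γ (Measure.hausdorffMeasure 1) with hμ
  have happly : ∀ A, μ A = Measure.hausdorffMeasure 1 (γ '' A) := fun A => hemb.comap_apply _ A
  have hlf : IsLocallyFiniteMeasure μ := by
    refine ⟨fun s => ?_⟩
    obtain ⟨K, hK⟩ := exists_gt ‖deriv γ s‖₊
    obtain ⟨r, hr, hr0⟩ := ((eventually_hausdorffMeasure_image_closedBall_le (hstrict s) hK).and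
      self_mem_nhdsWithin).exists
    refine ⟨closedBall s r, closedBall_mem_nhds s hr0, ?_⟩
    rw [happly]
    refine hr.trans_lt (ENNReal.mul_lt_top ENNReal.coe_lt_top ?_)
    exact (isCompact_closedBall s r).measure_lt_top
  have hac : μ ≪ volume := by
    intro A hA
    refine measure_null_of_locally_null _ fun s _ => ?_
    obtain ⟨K, hK⟩ := exists_gt ‖deriv γ s‖₊
    obtain ⟨t, ht, hlip⟩ := (hstrict s).hasStrictFDerivAt.exists_lipschitzOnWith_of_nnnorm_lt K
      (by simpa using hK)
    refine ⟨A ∩ t, inter_mem_nhdsWithin _ ht, ?_⟩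
    rw [happly]
    have := (hlip.mono (inter_subset_right (s := A))).hausdorffMeasure_image_le (d := 1) zero_le_one
    rw [hausdorffMeasure_real, measure_mono_null inter_subset_left hA, mul_zero] at this
    exact le_antisymm this bot_le
  -- Only the density of `μ` remains to be found. By Besicovitch differentiation it is a.e. the
  -- limit of the ratios on small intervals, which the two preceding lemmas squeeze to `‖γ'‖`.
  rw [← Measure.withDensity_rnDeriv_eq μ volume hac]
  refine withDensity_congr_ae ?_
  filter_upwards [Besicovitch.ae_tendsto_rnDeriv μ (volume : Measure ℝ)] with s hs
  have hpos : ∀ᶠ r in 𝓝[>] (0:ℝ), volume (closedBall s r) ≠ 0 ∧ volume (closedBall s r) ≠ ⊤ := by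
    filter_upwards [self_mem_nhdsWithin] with r hr
    exact ⟨(measure_closedBall_pos _ _ hr).ne', (isCompact_closedBall s r).measure_ne_top⟩
  refine le_antisymm ?_ ?_
  · by_contra! hcon
    obtain ⟨K, hK1, hK2⟩ := ENNReal.lt_iff_exists_nnreal_btwn.1 hcon
    refine hK2.not_ge (le_of_tendsto hs ?_)
    filter_upwards [eventually_hausdorffMeasure_image_closedBall_le (hstrict s)
      (ENNReal.coe_lt_coe.1 hK1)] with r hr
    rw [happly]
    exact ENNReal.div_le_of_le_mul hr
  · refine ENNReal.le_of_forall_nnreal_lt fun K hK => ge_of_tendsto hs ?_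
    filter_upwards [eventually_le_hausdorffMeasure_image_closedBall (hstrict s)
      (ENNReal.coe_lt_coe.1 hK), hpos] with r hr hr0
    rw [happly]
    exact (ENNReal.le_div_iff_mul_le (Or.inl hr0.1) (Or.inl hr0.2)).2 hr

/-! ### Gauss–Green below a graph, by shearing to a half-plane. -/

/-- The horizontal term has a constant coefficient, so it integrates to zero on every horizontal
line; the coefficient of the vertical term is constant on vertical half-lines, where the fundamental
theorem of calculus leaves the boundary value. These are the coefficients produced by the shear. -/
theorem setIntegral_lowerHalfPlane_fderiv {G : ℝ × ℝ → ℝ} (hG : ContDiff ℝ 1 G)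
    (hGc : HasCompactSupport G) (a : ℝ) {φ : ℝ → ℝ} (hφ : Continuous φ) :
    ∫ z in Set.univ ×ˢ Set.Iic (0 : ℝ),
      (a * fderiv ℝ G z (1, 0) + φ z.1 * fderiv ℝ G z (0, 1)) = ∫ s, φ s * G (s, 0) := by
  have hGd : Differentiable ℝ G := hG.differentiable one_ne_zero
  have hcont : ∀ v : ℝ × ℝ, Continuous fun z => fderiv ℝ G z v := fun v =>
    (hG.continuous_fderiv one_ne_zero).clm_apply continuous_const
  have hsupp : ∀ v : ℝ × ℝ, HasCompactSupport fun z => fderiv ℝ G z v := fun v =>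
    hGc.fderiv_apply (𝕜 := ℝ) v
  have hi1 : Integrable (fun z : ℝ × ℝ => a * fderiv ℝ G z (1, 0)) :=
    ((hcont _).integrable_of_hasCompactSupport (hsupp _)).const_mul a
  have hi2 : Integrable (fun z : ℝ × ℝ => φ z.1 * fderiv ℝ G z (0, 1)) :=
    ((hφ.comp continuous_fst).mul (hcont _)).integrable_of_hasCompactSupport (hsupp _).mul_left
  have hline1 : ∀ s t : ℝ, HasDerivAt (fun s => G (s, t)) (fderiv ℝ G (s, t) (1, 0)) s :=
    fun s t => (hGd (s, t)).hasFDerivAt.comp_hasDerivAt s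
      ((hasDerivAt_id s).prodMk (hasDerivAt_const s t))
  have hline2 : ∀ s t : ℝ, HasDerivAt (fun t => G (s, t)) (fderiv ℝ G (s, t) (0, 1)) t :=
    fun s t => (hGd (s, t)).hasFDerivAt.comp_hasDerivAt t
      ((hasDerivAt_const t s).prodMk (hasDerivAt_id t))
  have hsec1 : ∀ t : ℝ, HasCompactSupport fun s => G (s, t) := fun t =>
    hGc.comp_isClosedEmbedding ((Function.LeftInverse.isClosedEmbedding (f := Prod.fst)
      (fun _ => rfl) continuous_fst (Continuous.prodMk_left t)))
  have hsec2 : ∀ s : ℝ, HasCompactSupport fun t => G (s, t) := fun s =>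
    hGc.comp_isClosedEmbedding ((Function.LeftInverse.isClosedEmbedding (f := Prod.snd)
      (fun _ => rfl) continuous_snd (Continuous.prodMk_right s)))
  rw [integral_add hi1.integrableOn hi2.integrableOn]
  have h1 : ∫ z in Set.univ ×ˢ Set.Iic (0 : ℝ), a * fderiv ℝ G z (1, 0) = 0 := by
    rw [integral_const_mul, Measure.volume_eq_prod, ← Measure.prod_restrict, Measure.restrict_univ,
      integral_prod_symm]
    · have : ∀ t : ℝ, ∫ s : ℝ, fderiv ℝ G (s, t) (1, 0) = 0 := fun t => by
        refine integral_eq_zero_of_hasDerivAt_of_integrable (fun s => hline1 s t) ?_ ?_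
        · refine Continuous.integrable_of_hasCompactSupport
            ((hcont _).comp (Continuous.prodMk_left t)) ?_
          exact (hsupp (1, 0)).comp_isClosedEmbedding ((Function.LeftInverse.isClosedEmbedding (f := Prod.fst)
      (fun _ => rfl) continuous_fst (Continuous.prodMk_left t)))
        · exact (hG.continuous.comp (Continuous.prodMk_left t)).integrable_of_hasCompactSupport
            (hsec1 t)
      simp [this]
    · have := ((hcont (1, 0)).integrable_of_hasCompactSupport (μ := volume) (hsupp _)).integrableOn
        (s := Set.univ ×ˢ Set.Iic (0 : ℝ))
      rwa [IntegrableOn, Measure.volume_eq_prod, ← Measure.prod_restrict,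
        Measure.restrict_univ] at this
  have h2 : ∫ z in Set.univ ×ˢ Set.Iic (0 : ℝ), φ z.1 * fderiv ℝ G z (0, 1)
      = ∫ s, φ s * G (s, 0) := by
    rw [Measure.volume_eq_prod, ← Measure.prod_restrict, Measure.restrict_univ, integral_prod]
    · refine integral_congr_ae (Filter.Eventually.of_forall fun s => ?_)
      simp only
      rw [integral_const_mul]
      congr 1
      rw [← HasCompactSupport.integral_Iic_deriv_eq (f := fun t => G (s, t))
        (hG.comp (contDiff_prodMk_right s)) (hsec2 s) 0]
      exact integral_congr_ae (Filter.Eventually.of_forall fun t => (hline2 s t).deriv.symm)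
    · have := hi2.integrableOn (s := Set.univ ×ˢ Set.Iic (0 : ℝ))
      rwa [IntegrableOn, Measure.volume_eq_prod, ← Measure.prod_restrict,
        Measure.restrict_univ] at this
  rw [h1, h2, zero_add]

/-- The shear of the plane straightening the graph of `g`. -/
def shear (g : ℝ → ℝ) (hg : Continuous g) : ℝ × ℝ ≃ₜ ℝ × ℝ where
  toFun z := (z.1, g z.1 + z.2)
  invFun z := (z.1, z.2 - g z.1)
  left_inv z := by simp
  right_inv z := by simp
  continuous_toFun := by fun_prop
  continuous_invFun := by fun_prop

theorem measurePreserving_shear {g : ℝ → ℝ} (hg : Continuous g) :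
    MeasurePreserving (shear g hg) volume volume := by
  rw [Measure.volume_eq_prod]
  refine (MeasurePreserving.id (volume : Measure ℝ)).skew_product (g := fun s t => g s + t) ?_ ?_
  · exact (show Continuous (Function.uncurry fun s t => g s + t) by
      unfold Function.uncurry; fun_prop).measurable
  · exact Filter.Eventually.of_forall fun s => map_add_left_eq_self _ _

/-- The Gauss–Green formula in the region below the graph of a `C¹` function. -/
theorem setIntegral_subgraph_fderiv {g : ℝ → ℝ} (hg : ContDiff ℝ 1 g) {H : ℝ × ℝ → ℝ}
    (hH : ContDiff ℝ 1 H) (hHc : HasCompactSupport H) (a b : ℝ) :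
    ∫ z in {z : ℝ × ℝ | z.2 < g z.1}, fderiv ℝ H z (a, b) =
      ∫ s, (b - a * deriv g s) * H (s, g s) := by
  have hgc := hg.continuous
  set S := shear g hgc with hS
  have hSd : ContDiff ℝ 1 S := by
    show ContDiff ℝ 1 fun z : ℝ × ℝ => (z.1, g z.1 + z.2)
    fun_prop
  have hG : ContDiff ℝ 1 (H ∘ S) := hH.comp hSd
  have hGc : HasCompactSupport (H ∘ S) := hHc.comp_homeomorph S
  have hder : ∀ z c d, fderiv ℝ (H ∘ S) z (c, d) = fderiv ℝ H (S z) (c, deriv g z.1 * c + d) := by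
    intro z c d
    rw [fderiv_comp z ((hH.differentiable one_ne_zero) _) ((hSd.differentiable one_ne_zero) z)]
    have h1 : HasFDerivAt S ((ContinuousLinearMap.fst ℝ ℝ ℝ).prod
        ((deriv g z.1) • ContinuousLinearMap.fst ℝ ℝ ℝ + ContinuousLinearMap.snd ℝ ℝ ℝ)) z := by
      refine HasFDerivAt.prodMk hasFDerivAt_fst (HasFDerivAt.add ?_ hasFDerivAt_snd)
      exact ((hg.differentiable one_ne_zero) z.1).hasDerivAt.comp_hasFDerivAt z hasFDerivAt_fst
    rw [h1.fderiv]
    simp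
  have hmp := measurePreserving_shear hgc
  have hpre : S ⁻¹' {z : ℝ × ℝ | z.2 < g z.1} = Set.univ ×ˢ Set.Iio 0 := by
    ext z
    simp [hS, shear]
  rw [← hmp.setIntegral_preimage_emb S.measurableEmbedding, hpre]
  have hae : (Set.univ ×ˢ Set.Iio (0 : ℝ) : Set (ℝ × ℝ)) =ᵐ[volume] Set.univ ×ˢ Set.Iic (0 : ℝ) := by
    rw [Measure.volume_eq_prod]
    exact Measure.set_prod_ae_eq (Filter.EventuallyEq.rfl) Iio_ae_eq_Iic
  rw [setIntegral_congr_set hae]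
  have := setIntegral_lowerHalfPlane_fderiv hG hGc a (φ := fun s => b - a * deriv g s)
    (by have := hg.continuous_deriv le_rfl; fun_prop)
  simp only [hder] at this
  convert this using 2
  · ext z
    -- The two vectors on the right are the images of the coordinate vectors under the derivative of
    -- the shear.
    have : ((a, b) : ℝ × ℝ) = a • ((1 : ℝ), deriv g z.1 * 1 + 0) +
        (b - a * deriv g z.1) • ((0 : ℝ), deriv g z.1 * 0 + 1) := by
      ext <;> simp
    show fderiv ℝ H (S z) (a, b) = _
    rw [this, map_add, map_smul, map_smul]
    simp
  · ext s
    simp [hS, shear]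

/-! ### Cut-offs and orthonormal coordinates. -/

open Topology in
/-- A function that is `C¹` at a point, cut off outside a small ball, is globally `C¹`. -/
theorem ContDiffBump.contDiff_mul_of_contDiffAt {E : Type*} [NormedAddCommGroup E]
    [NormedSpace ℝ E] [HasContDiffBump E] [FiniteDimensional ℝ E] {x : E} (β : ContDiffBump x)
    {f : E → ℝ} (hf : ∀ y ∈ Metric.closedBall x β.rOut, ContDiffAt ℝ 1 f y) :
    ContDiff ℝ 1 fun y => β y * f y := by
  rw [contDiff_iff_contDiffAt]
  intro y
  by_cases hy : y ∈ Metric.closedBall x β.rOut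
  · exact (β.contDiff.contDiffAt).mul (hf y hy)
  · rw [← β.tsupport_eq, notMem_tsupport_iff_eventuallyEq] at hy
    refine (contDiffAt_const (c := (0 : ℝ))).congr_of_eventuallyEq ?_
    filter_upwards [hy] with z hz
    simp [hz]

-- Replaces an implicit function, known to be `C¹` only near its base point, by one that is `C¹` on
-- the whole line, so that the subgraph formula applies.
open Topology in
theorem ContDiffAt.exists_contDiff_eventuallyEq {E : Type*} [NormedAddCommGroup E]
    [NormedSpace ℝ E] [HasContDiffBump E] [FiniteDimensional ℝ E] {x : E} {f : E → ℝ}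
    (hf : ContDiffAt ℝ 1 f x) : ∃ g : E → ℝ, ContDiff ℝ 1 g ∧ g =ᶠ[𝓝 x] f := by
  obtain ⟨r, hr, h⟩ := Metric.nhds_basis_closedBall.mem_iff.1 (hf.eventually (by simp))
  let β : ContDiffBump x := ⟨r / 2, r, by positivity, by linarith⟩
  refine ⟨_, β.contDiff_mul_of_contDiffAt fun y hy => h hy, ?_⟩
  filter_upwards [β.eventuallyEq_one] with y hy
  simp [hy]

/-- The identification of the plane with `ℂ`. -/
noncomputable def toComplex : Plane ≃ₗᵢ[ℝ] ℂ := Complex.orthonormalBasisOneI.repr.symm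

theorem exists_linearIsometryEquiv_apply_I (e : Plane) (he : ‖e‖ = 1) :
    ∃ L : ℂ ≃ₗᵢ[ℝ] Plane, L Complex.I = e := by
  have h : ‖toComplex e * (-Complex.I)‖ = 1 := by simp [he]
  have hmem : toComplex e * (-Complex.I) ∈ Submonoid.unitSphere ℂ := mem_sphere_zero_iff_norm.2 h
  obtain ⟨c, hc⟩ : ∃ c : Circle, (c : ℂ) = toComplex e * (-Complex.I) := ⟨⟨_, hmem⟩, rfl⟩
  refine ⟨(rotation c).trans toComplex.symm, ?_⟩
  rw [LinearIsometryEquiv.trans_apply, rotation_apply, hc, mul_assoc]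
  simp

/-- The orthonormal coordinates of the plane with origin `x₀` given by `L`. -/
noncomputable def frame (L : ℂ ≃ₗᵢ[ℝ] Plane) (x₀ : Plane) : ℝ × ℝ ≃ₜ Plane :=
  (Complex.equivRealProdCLM.symm.toHomeomorph).trans
    (L.toHomeomorph.trans (Homeomorph.addLeft x₀))

theorem frame_apply (L : ℂ ≃ₗᵢ[ℝ] Plane) (x₀ : Plane) (z : ℝ × ℝ) :
    frame L x₀ z = x₀ + L (Complex.equivRealProdCLM.symm z) := rfl

theorem frame_zero (L : ℂ ≃ₗᵢ[ℝ] Plane) (x₀ : Plane) : frame L x₀ 0 = x₀ := by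
  simp [frame_apply]

theorem contDiff_frame (L : ℂ ≃ₗᵢ[ℝ] Plane) (x₀ : Plane) {n : WithTop ℕ∞} :
    ContDiff ℝ n (frame L x₀) :=
  contDiff_const.add (L.toContinuousLinearEquiv.contDiff.comp
    Complex.equivRealProdCLM.symm.contDiff)

theorem hasFDerivAt_frame (L : ℂ ≃ₗᵢ[ℝ] Plane) (x₀ : Plane) (z : ℝ × ℝ) :
    HasFDerivAt (frame L x₀)
      ((L.toContinuousLinearEquiv : ℂ →L[ℝ] Plane).comp
        (Complex.equivRealProdCLM.symm : ℝ × ℝ →L[ℝ] ℂ)) z :=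
  ((L.toContinuousLinearEquiv : ℂ →L[ℝ] Plane).comp
        (Complex.equivRealProdCLM.symm : ℝ × ℝ →L[ℝ] ℂ)).hasFDerivAt.const_add x₀

theorem measurePreserving_frame (L : ℂ ≃ₗᵢ[ℝ] Plane) (x₀ : Plane) :
    MeasurePreserving (frame L x₀) volume volume := by
  have h1 : MeasurePreserving (Complex.equivRealProdCLM.symm : ℝ × ℝ → ℂ) volume volume :=
    Complex.volume_preserving_equiv_real_prod.symm
  exact (measurePreserving_add_left volume x₀).comp (L.measurePreserving.comp h1)

theorem mem_ball_of_frame_mem_ball {L : ℂ ≃ₗᵢ[ℝ] Plane} {x₀ : Plane} {r : ℝ} {z : ℝ × ℝ}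
    (h : frame L x₀ z ∈ Metric.ball x₀ r) : |z.1| < r ∧ |z.2| < r := by
  rw [mem_ball_iff_norm, frame_apply, add_sub_cancel_left, L.norm_map] at h
  exact ⟨(Complex.abs_re_le_norm _).trans_lt h, (Complex.abs_im_le_norm _).trans_lt h⟩

theorem frontier_subgraph {g : ℝ → ℝ} (hg : Continuous g) :
    frontier {z : ℝ × ℝ | z.2 < g z.1} = {z : ℝ × ℝ | z.2 = g z.1} := by
  have h1 : {z : ℝ × ℝ | z.2 < g z.1} = (shear g hg).symm ⁻¹' (Set.univ ×ˢ Set.Iio (0 : ℝ)) := by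
    ext z
    simp [shear]
  rw [h1, ← Homeomorph.preimage_frontier, frontier_univ_prod_eq, frontier_Iio]
  ext z
  simp [shear, sub_eq_zero]

/-! ### Defining functions, the outward normal, and the boundary as a local graph. -/

open Topology in
theorem IsDefiningFunctionAt.eventually {Ω : Set Plane} {x₀ : Plane} {φ : Plane → ℝ}
    (h : IsDefiningFunctionAt Ω x₀ φ) :
    ∀ᶠ y in 𝓝 x₀, φ y = 0 → IsDefiningFunctionAt Ω y φ := by
  obtain ⟨r, hr, hmem⟩ := h.mem_iff
  have hgrad : Continuous (gradient φ) := by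
    unfold gradient
    exact (LinearIsometryEquiv.continuous _).comp (h.smooth.continuous_fderiv (by simp))
  filter_upwards [hgrad.continuousAt.eventually_ne h.gradient_ne_zero,
    Metric.ball_mem_nhds x₀ hr] with y hy hyr hy0
  refine ⟨h.smooth, hy0, hy, ?_⟩
  obtain ⟨r', hr', hsub⟩ := Metric.isOpen_iff.1 Metric.isOpen_ball y hyr
  exact ⟨r', hr', fun z hz => hmem z (hsub hz)⟩

-- A short move from `x` along `v` makes `φ` negative, hence enters `Ω`, hence makes `ψ` negative as
-- well.
open Topology in
theorem IsDefiningFunctionAt.fderiv_nonpos {Ω : Set Plane} {x : Plane} {φ ψ : Plane → ℝ}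
    (hφ : IsDefiningFunctionAt Ω x φ) (hψ : IsDefiningFunctionAt Ω x ψ) {v : Plane}
    (hv : fderiv ℝ φ x v < 0) : fderiv ℝ ψ x v ≤ 0 := by
  by_contra! hcon
  have hline : Filter.Tendsto (fun t : ℝ => x + t • v) (𝓝[>] 0) (𝓝 x) := by
    have : ContinuousAt (fun t : ℝ => x + t • v) 0 := by fun_prop
    simpa using this.tendsto.mono_left nhdsWithin_le_nhds
  have hslope : ∀ χ : Plane → ℝ, IsDefiningFunctionAt Ω x χ →
      Filter.Tendsto (fun t : ℝ => t⁻¹ * χ (x + t • v)) (𝓝[>] 0) (𝓝 (fderiv ℝ χ x v)) := by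
    intro χ hχ
    have h1 : HasDerivAt (fun t : ℝ => x + t • v) v 0 := by
      simpa using ((hasDerivAt_id (0 : ℝ)).smul_const v).const_add x
    have h2 : HasFDerivAt χ (fderiv ℝ χ x) (x + (0 : ℝ) • v) := by
      simpa using (hχ.smooth.differentiable (by simp) x).hasFDerivAt
    simpa [hχ.eq_zero] using (h2.comp_hasDerivAt 0 h1).tendsto_slope_zero_right
  obtain ⟨r, hr, hmem⟩ := hφ.mem_iff
  obtain ⟨r', hr', hmem'⟩ := hψ.mem_iff
  obtain ⟨t, h1, h2, h3, h4, h5⟩ := ((hslope φ hφ).eventually_lt_const hv |>.and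
    (((hslope ψ hψ).eventually_const_lt hcon).and
    ((hline.eventually (Metric.ball_mem_nhds x hr)).and
    ((hline.eventually (Metric.ball_mem_nhds x hr')).and self_mem_nhdsWithin)))).exists
  have h5 : 0 < t := h5
  have h6 : φ (x + t • v) < 0 := by
    by_contra! hc
    exact h1.not_ge (mul_nonneg (by positivity) hc)
  have h7 := (hmem' _ h4).1 ((hmem _ h3).2 h6)
  exact h2.not_ge (mul_nonpos_of_nonneg_of_nonpos (by positivity) h7.le)

open scoped RealInnerProductSpace in
theorem IsOutwardUnitNormalAt.unique {Ω : Set Plane} {x n m : Plane}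
    (hn : IsOutwardUnitNormalAt Ω x n) (hm : IsOutwardUnitNormalAt Ω x m) : n = m := by
  obtain ⟨φ, hφ, rfl⟩ := hn
  obtain ⟨ψ, hψ, rfl⟩ := hm
  set a := gradient φ x with ha
  set c := gradient ψ x with hc
  have hap : 0 < ‖a‖ := norm_pos_iff.2 hφ.gradient_ne_zero
  have hcp : 0 < ‖c‖ := norm_pos_iff.2 hψ.gradient_ne_zero
  -- The test vector is the difference of the two unit normals. Were Cauchy–Schwarz strict for the
  -- gradients, moving along it would decrease `φ` and increase `ψ` to first order.
  have key := hφ.fderiv_nonpos hψ (v := ‖c‖⁻¹ • c - ‖a‖⁻¹ • a)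
  rw [← inner_gradient_left, ← inner_gradient_left, ← ha, ← hc, inner_sub_right, inner_sub_right,
    real_inner_smul_right, real_inner_smul_right, real_inner_smul_right, real_inner_smul_right,
    real_inner_self_eq_norm_sq, real_inner_self_eq_norm_sq, real_inner_comm] at key
  have hle := real_inner_le_norm a c
  have hge : ‖a‖ * ‖c‖ ≤ ⟪a, c⟫ := by
    by_contra! hlt
    have h1 : ‖c‖⁻¹ * ⟪a, c⟫ - ‖a‖⁻¹ * ‖a‖ ^ 2 < 0 := by
      field_simp
      nlinarith
    have h2 := key (by rwa [real_inner_comm])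
    have h3 : 0 < ‖c‖⁻¹ * ‖c‖ ^ 2 - ‖a‖⁻¹ * ⟪a, c⟫ := by
      field_simp
      nlinarith
    rw [real_inner_comm] at h3
    linarith [real_inner_comm a c]
  have heq : ⟪a, c⟫ = ‖a‖ * ‖c‖ := le_antisymm hle hge
  have := (inner_eq_norm_mul_iff_real).1 heq
  rw [inv_smul_eq_iff₀ hap.ne', smul_comm, eq_inv_smul_iff₀ hcp.ne']
  exact this

theorem IsOutwardUnitNormalAt.norm_eq_one {Ω : Set Plane} {x n : Plane}
    (hn : IsOutwardUnitNormalAt Ω x n) : ‖n‖ = 1 := by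
  obtain ⟨φ, hφ, rfl⟩ := hn
  rw [norm_smul, norm_inv, norm_norm, inv_mul_cancel₀ (norm_ne_zero_iff.2 hφ.gradient_ne_zero)]

open Topology in
theorem IsDefiningFunctionAt.eventually_frontier {Ω : Set Plane} {x : Plane} {φ : Plane → ℝ}
    (hΩ : IsOpen Ω) (h : IsDefiningFunctionAt Ω x φ) :
    ∀ᶠ y in 𝓝 x, y ∈ frontier Ω → φ y = 0 := by
  obtain ⟨r, hr, hmem⟩ := h.mem_iff
  filter_upwards [Metric.ball_mem_nhds x hr] with y hy hyf
  rw [hΩ.frontier_eq] at hyf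
  refine le_antisymm ?_ (not_lt.1 fun hlt => hyf.2 ((hmem y hy).2 hlt))
  by_contra! hpos
  have hopen : {z | 0 < φ z} ∩ Metric.ball x r ∈ 𝓝 y :=
    ((isOpen_lt continuous_const h.smooth.continuous).inter Metric.isOpen_ball).mem_nhds ⟨hpos, hy⟩
  obtain ⟨z, hz1, hz2⟩ := mem_closure_iff_nhds.1 hyf.1 _ hopen
  exact lt_asymm ((hmem z hz1.2).1 hz2) hz1.1

-- By uniqueness, `ν` agrees near a boundary point with the normalized gradient of a single defining
-- function.
open Topology Filter in
theorem continuousOn_outwardUnitNormal {Ω : Set Plane} (hΩ : IsOpen Ω) {ν : Plane → Plane}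
    (hν : ∀ x ∈ frontier Ω, IsOutwardUnitNormalAt Ω x (ν x)) :
    ContinuousOn ν (frontier Ω) := by
  intro x hx
  obtain ⟨φ, hφ, hφν⟩ := hν x hx
  have hgrad : Continuous (gradient φ) := by
    unfold gradient
    exact (LinearIsometryEquiv.continuous _).comp (hφ.smooth.continuous_fderiv (by simp))
  have hcont : ContinuousAt (fun y => ‖gradient φ y‖⁻¹ • gradient φ y) x :=
    (hgrad.norm.continuousAt.inv₀ (norm_ne_zero_iff.2 hφ.gradient_ne_zero)).smul hgrad.continuousAt
  refine (hcont.continuousWithinAt (s := frontier Ω)).congr_of_eventuallyEq ?_ hφν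
  filter_upwards [self_mem_nhdsWithin, mem_nhdsWithin_of_mem_nhds hφ.eventually,
    mem_nhdsWithin_of_mem_nhds (hφ.eventually_frontier hΩ)] with y hy h1 h2
  exact (hν y hy).unique ⟨φ, h1 (h2 hy), rfl⟩

-- The second axis of the frame points along the gradient of `φ`, so `φ` increases in that direction
-- and the implicit function theorem supplies `g`, with `Ω` below its graph.
open Topology in
theorem IsDefiningFunctionAt.exists_local_graph {Ω : Set Plane} {x₀ : Plane} {φ : Plane → ℝ}
    (h : IsDefiningFunctionAt Ω x₀ φ) :
    ∃ (L : ℂ ≃ₗᵢ[ℝ] Plane) (g : ℝ → ℝ), ContDiff ℝ 1 g ∧ ∃ r > 0,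
      (∀ z, frame L x₀ z ∈ Metric.ball x₀ r → (frame L x₀ z ∈ Ω ↔ z.2 < g z.1)) ∧
      ∀ s, frame L x₀ (s, g s) ∈ Metric.ball x₀ r →
        IsOutwardUnitNormalAt Ω (frame L x₀ (s, g s))
          (‖(⟨-deriv g s, 1⟩ : ℂ)‖⁻¹ • L ⟨-deriv g s, 1⟩) := by
  have hap : 0 < ‖gradient φ x₀‖ := norm_pos_iff.2 h.gradient_ne_zero
  obtain ⟨L, hL⟩ := exists_linearIsometryEquiv_apply_I (‖gradient φ x₀‖⁻¹ • gradient φ x₀) (by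
    rw [norm_smul, norm_inv, norm_norm, inv_mul_cancel₀ hap.ne'])
  set Φ := frame L x₀ with hΦ
  have hφd : Differentiable ℝ φ := h.smooth.differentiable (by simp)
  have hϕ : ContDiff ℝ 1 (φ ∘ Φ) := (h.smooth.of_le (by simp)).comp (contDiff_frame L x₀)
  have hder : ∀ z a c, fderiv ℝ (φ ∘ Φ) z (a, c) = fderiv ℝ φ (Φ z) (L ⟨a, c⟩) := by
    intro z a c
    rw [((hφd (Φ z)).hasFDerivAt.comp z (hasFDerivAt_frame L x₀ z)).fderiv]
    rfl
  have hpos0 : 0 < fderiv ℝ (φ ∘ Φ) 0 (0, 1) := by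
    rw [hder, hΦ, frame_zero, ← inner_gradient_left]
    show 0 < inner ℝ (gradient φ x₀) (L Complex.I)
    rw [hL, real_inner_smul_right, real_inner_self_eq_norm_sq]
    positivity
  have hinv : (fderiv ℝ (φ ∘ Φ) 0 ∘L .inr ℝ ℝ ℝ).IsInvertible := by
    refine ⟨ContinuousLinearEquiv.unitsEquivAut ℝ (Units.mk0 _ hpos0.ne'), ?_⟩
    ext
    simp
  have hcd : ContDiffAt ℝ 1 (φ ∘ Φ) (0 : ℝ × ℝ) := hϕ.contDiffAt
  obtain ⟨g, hg, hgg⟩ :=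
    (hcd.contDiffAt_implicitFunction one_ne_zero hinv).exists_contDiff_eventuallyEq
  have hΦ0 : (φ ∘ Φ) 0 = 0 := by rw [Function.comp_apply, hΦ, frame_zero, h.eq_zero]
  have hg0 : g 0 = 0 := by
    rw [show (0 : ℝ) = (0 : ℝ × ℝ).1 from rfl, hgg.eq_of_nhds]
    exact hcd.implicitFunction_apply_self one_ne_zero hinv
  have hgz : ∀ᶠ s in 𝓝 (0 : ℝ), (φ ∘ Φ) (s, g s) = 0 := by
    filter_upwards [hgg, hcd.eventually_apply_implicitFunction one_ne_zero hinv] with s h1 h2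
    rw [h1, h2, hΦ0]
  obtain ⟨ρ, hρ, hmem⟩ := h.mem_iff
  have hev : ∀ᶠ z in 𝓝 (0 : ℝ × ℝ), 0 < fderiv ℝ (φ ∘ Φ) z (0, 1) ∧ Φ z ∈ Metric.ball x₀ ρ := by
    refine Filter.Eventually.and ?_ ?_
    · exact ((hϕ.continuous_fderiv one_ne_zero).clm_apply continuous_const).continuousAt.eventually
        (lt_mem_nhds hpos0)
    · refine Φ.continuous.continuousAt.eventually (Metric.isOpen_ball.mem_nhds ?_)
      rw [hΦ, frame_zero]
      exact Metric.mem_ball_self hρ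
  obtain ⟨δ, hδ, hbox⟩ := Metric.eventually_nhds_iff_ball.1 hev
  have hsmall : ∀ᶠ s in 𝓝 (0 : ℝ), |g s| < δ := by
    refine hg.continuous.abs.continuousAt.eventually (gt_mem_nhds ?_)
    simpa [hg0] using hδ
  obtain ⟨δ', hδ', hs'⟩ := Metric.eventually_nhds_iff_ball.1 (hsmall.and hgz.eventually_nhds)
  have hinbox : ∀ s t : ℝ, |s| < δ → |t| < δ → (s, t) ∈ Metric.ball (0 : ℝ × ℝ) δ := by
    intro s t hs ht
    simp [Prod.norm_def, hs, ht]
  refine ⟨L, g, hg, min δ δ', lt_min hδ hδ', ?_, ?_⟩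
  · rintro ⟨s, t⟩ hz
    obtain ⟨hs, ht⟩ := mem_ball_of_frame_mem_ball hz
    rw [lt_min_iff] at hs ht
    obtain ⟨hgs, hgs0⟩ := hs' s (by simpa using hs.2)
    -- On a vertical segment of the box `φ` increases and vanishes at height `g s`, so its sign is
    -- that of `t - g s`.
    have hmono : StrictMonoOn (fun t => (φ ∘ Φ) (s, t)) (Set.Ioo (-δ) δ) := by
      refine strictMonoOn_of_deriv_pos (convex_Ioo _ _)
        (hϕ.continuous.comp (Continuous.prodMk_right s)).continuousOn fun t ht => ?_
      rw [interior_Ioo] at ht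
      have hd : HasDerivAt (fun t => (φ ∘ Φ) (s, t)) (fderiv ℝ (φ ∘ Φ) (s, t) (0, 1)) t :=
        ((hϕ.differentiable one_ne_zero) (s, t)).hasFDerivAt.comp_hasDerivAt t
          ((hasDerivAt_const t s).prodMk (hasDerivAt_id t))
      rw [hd.deriv]
      exact (hbox _ (hinbox s t hs.1 (abs_lt.2 ht))).1
    rw [hmem _ (hbox _ (hinbox s t hs.1 ht.1)).2]
    have := hmono.lt_iff_lt (abs_lt.1 ht.1) (abs_lt.1 hgs)
    simp only [hgs0.self_of_nhds] at this
    exact this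
  · intro s hz
    obtain ⟨hs, ht⟩ := mem_ball_of_frame_mem_ball hz
    rw [lt_min_iff] at hs ht
    obtain ⟨hgs, hgs0⟩ := hs' s (by simpa using hs.2)
    obtain ⟨hb, hball⟩ := hbox _ (hinbox s (g s) hs.1 ht.1)
    set y := Φ (s, g s) with hy
    -- Since `φ` vanishes along the graph, its gradient is orthogonal to the tangent `(1, g')`. It
    -- is thus a multiple of `(-g', 1)`, and the factor `c` is positive.
    have hzero : fderiv ℝ φ y (L ⟨1, deriv g s⟩) = 0 := by
      rw [← hder]
      have hd : HasDerivAt (fun s => (φ ∘ Φ) (s, g s))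
          (fderiv ℝ (φ ∘ Φ) (s, g s) (1, deriv g s)) s :=
        ((hϕ.differentiable one_ne_zero) (s, g s)).hasFDerivAt.comp_hasDerivAt s
          ((hasDerivAt_id s).prodMk ((hg.differentiable one_ne_zero) s).hasDerivAt)
      rw [← hd.deriv]
      exact (Filter.EventuallyEq.deriv_eq (f := fun _ => (0 : ℝ)) hgs0).trans (deriv_const _ _)
    rw [hder, ← hy] at hb
    set c := fderiv ℝ φ y (L ⟨0, 1⟩) with hc
    have hgrad : gradient φ y = c • L ⟨-deriv g s, 1⟩ := by
      obtain ⟨w, hw⟩ := L.surjective (gradient φ y)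
      have hin : ∀ v : ℂ, inner ℝ w v = fderiv ℝ φ y (L v) := fun v => by
        rw [← inner_gradient_left, ← hw, L.inner_map_map]
      have h1 : w.im = c := by
        rw [hc, ← hin]
        simp [Complex.inner]
      have h2 : w.re + w.im * deriv g s = 0 := by
        rw [← hzero, ← hin]
        simp [Complex.inner]
        ring
      rw [← hw, ← map_smul]
      congr 1
      apply Complex.ext
      · simp
        rw [← h1]
        linarith
      · simp [h1]
    have hne : (⟨-deriv g s, 1⟩ : ℂ) ≠ 0 := fun h0 => by simpa using congrArg Complex.im h0
    have hne' : gradient φ y ≠ 0 := by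
      rw [hgrad]
      simp [hb.ne', hne]
    refine ⟨φ, ⟨h.smooth, hgs0.self_of_nhds, hne', ?_⟩, ?_⟩
    · obtain ⟨r', hr', hsub⟩ := Metric.isOpen_iff.1 Metric.isOpen_ball y hball
      exact ⟨r', hr', fun z hz => hmem z (hsub hz)⟩
    · rw [hgrad, norm_smul, L.norm_map, smul_smul, Real.norm_of_nonneg hb.le]
      congr 1
      field_simp

/-! ### Gauss–Green near one boundary point. -/

theorem setIntegral_eq_of_inter_eq {X : Type*} [MeasurableSpace X] {μ : Measure X} {A D U : Set X}
    (hA : MeasurableSet A) (hD : MeasurableSet D) {f : X → ℝ} (hf : ∀ x, x ∉ U → f x = 0)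
    (h : ∀ x ∈ U, x ∈ A ↔ x ∈ D) : ∫ x in A, f x ∂μ = ∫ x in D, f x ∂μ := by
  rw [← integral_indicator hA, ← integral_indicator hD]
  congr 1
  ext x
  by_cases hx : x ∈ U
  · by_cases hxA : x ∈ A
    · rw [Set.indicator_of_mem hxA, Set.indicator_of_mem ((h x hx).1 hxA)]
    · rw [Set.indicator_of_notMem hxA, Set.indicator_of_notMem fun hd => hxA ((h x hx).2 hd)]
  · simp [Set.indicator, hf x hx]

section LocalGraph

variable {Ω : Set Plane} {L : ℂ ≃ₗᵢ[ℝ] Plane} {x₀ : Plane} {g : ℝ → ℝ} {r : ℝ}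

theorem frame_mem_frontier_iff (hg : ContDiff ℝ 1 g)
    (hsub : ∀ z, frame L x₀ z ∈ Metric.ball x₀ r → (frame L x₀ z ∈ Ω ↔ z.2 < g z.1))
    {z : ℝ × ℝ} (hz : frame L x₀ z ∈ Metric.ball x₀ r) :
    frame L x₀ z ∈ frontier Ω ↔ z.2 = g z.1 := by
  set U := frame L x₀ ⁻¹' Metric.ball x₀ r with hU
  have hUo : IsOpen U := Metric.isOpen_ball.preimage (frame L x₀).continuous
  have h1 : frame L x₀ ⁻¹' Ω ∩ U = {z : ℝ × ℝ | z.2 < g z.1} ∩ U := by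
    ext w
    exact and_congr_left fun hw => hsub w hw
  have h2 := frontier_inter_open_inter (s := frame L x₀ ⁻¹' Ω) hUo
  rw [h1, frontier_inter_open_inter hUo, frontier_subgraph hg.continuous,
    ← Homeomorph.preimage_frontier] at h2
  have h3 := Set.ext_iff.1 h2 z
  exact ⟨fun h => (h3.2 ⟨h, hz⟩).1, fun h => (h3.1 ⟨h, hz⟩).1⟩

theorem contDiff_graph (hg : ContDiff ℝ 1 g) : ContDiff ℝ 1 fun s => frame L x₀ (s, g s) :=
  (contDiff_frame L x₀).comp (contDiff_id.prodMk hg)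

theorem injective_graph : Function.Injective fun s => frame L x₀ (s, g s) := fun a b hab => by
  simpa using congrArg Prod.fst ((frame L x₀).injective hab)

theorem norm_deriv_graph (hg : ContDiff ℝ 1 g) (s : ℝ) :
    ‖deriv (fun s => frame L x₀ (s, g s)) s‖ = ‖(⟨-deriv g s, 1⟩ : ℂ)‖ := by
  have hd : HasDerivAt (fun s => frame L x₀ (s, g s)) (L ⟨1, deriv g s⟩) s :=
    HasFDerivAt.comp_hasDerivAt (l := frame L x₀) (f := fun s => (s, g s)) s
      (hasFDerivAt_frame L x₀ (s, g s))
      ((hasDerivAt_id s).prodMk ((hg.differentiable one_ne_zero) s).hasDerivAt)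
  rw [hd.deriv, L.norm_map, Complex.norm_eq_sqrt_sq_add_sq, Complex.norm_eq_sqrt_sq_add_sq]
  congr 1
  ring

theorem setIntegral_frontier_eq_graph (hg : ContDiff ℝ 1 g)
    (hsub : ∀ z, frame L x₀ z ∈ Metric.ball x₀ r → (frame L x₀ z ∈ Ω ↔ z.2 < g z.1))
    {f : Plane → ℝ} (hf : ∀ x, x ∉ Metric.ball x₀ r → f x = 0) :
    ∫ x in frontier Ω, f x ∂(Measure.hausdorffMeasure 1) =
      ∫ s, ‖(⟨-deriv g s, 1⟩ : ℂ)‖ * f (frame L x₀ (s, g s)) := by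
  have hγ := contDiff_graph (L := L) (x₀ := x₀) hg
  have hemb : MeasurableEmbedding fun s => frame L x₀ (s, g s) :=
    hγ.continuous.measurableEmbedding injective_graph
  rw [setIntegral_eq_of_inter_eq (D := Set.range fun s => frame L x₀ (s, g s))
    isClosed_frontier.measurableSet hemb.measurableSet_range hf, ← hemb.map_comap,
    hemb.integral_map, comap_hausdorffMeasure_eq_withDensity hγ injective_graph,
    integral_withDensity_eq_integral_smul]
  · refine integral_congr_ae (Filter.Eventually.of_forall fun s => ?_)
    simp only [NNReal.smul_def, coe_nnnorm, norm_deriv_graph hg, smul_eq_mul]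
  · exact (hγ.continuous_deriv le_rfl).nnnorm.measurable
  · intro x hx
    obtain ⟨z, rfl⟩ := (frame L x₀).surjective x
    rw [frame_mem_frontier_iff hg hsub hx]
    constructor
    · intro h
      exact ⟨z.1, by simp only [← h]⟩
    · rintro ⟨s, hs⟩
      rw [← (frame L x₀).injective hs]

theorem hausdorffMeasure_frontier_inter_ball_lt_top (hg : ContDiff ℝ 1 g)
    (hsub : ∀ z, frame L x₀ z ∈ Metric.ball x₀ r → (frame L x₀ z ∈ Ω ↔ z.2 < g z.1)) :
    Measure.hausdorffMeasure 1 (frontier Ω ∩ Metric.ball x₀ r) < ⊤ := by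
  have hγ := contDiff_graph (L := L) (x₀ := x₀) hg
  have hemb : MeasurableEmbedding fun s => frame L x₀ (s, g s) :=
    hγ.continuous.measurableEmbedding injective_graph
  have hsubset : frontier Ω ∩ Metric.ball x₀ r ⊆
      (fun s => frame L x₀ (s, g s)) '' Set.Icc (-r) r := by
    rintro x ⟨hx, hxr⟩
    obtain ⟨z, rfl⟩ := (frame L x₀).surjective x
    rw [frame_mem_frontier_iff hg hsub hxr] at hx
    exact ⟨z.1, abs_le.1 (mem_ball_of_frame_mem_ball hxr).1.le, by simp only [← hx]⟩
  refine (measure_mono hsubset).trans_lt ?_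
  rw [← hemb.comap_apply, comap_hausdorffMeasure_eq_withDensity hγ injective_graph]
  have := IsLocallyFiniteMeasure.withDensity_coe (μ := (volume : Measure ℝ))
    ((hγ.continuous_deriv le_rfl).nnnorm)
  exact isCompact_Icc.measure_lt_top

-- In the coordinates of the frame this is the subgraph formula: the arc length density `√(1 + g'²)`
-- cancels the factor normalizing `(-g', 1)`.
open scoped RealInnerProductSpace in
theorem setIntegral_fderiv_eq_of_local_graph (hΩ : IsOpen Ω) (hg : ContDiff ℝ 1 g)
    (hsub : ∀ z, frame L x₀ z ∈ Metric.ball x₀ r → (frame L x₀ z ∈ Ω ↔ z.2 < g z.1))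
    {ν : Plane → Plane} (hν : ∀ s, frame L x₀ (s, g s) ∈ Metric.ball x₀ r →
      ν (frame L x₀ (s, g s)) = ‖(⟨-deriv g s, 1⟩ : ℂ)‖⁻¹ • L ⟨-deriv g s, 1⟩)
    {f : Plane → ℝ} (hf : ContDiff ℝ 1 f) (hfc : HasCompactSupport f)
    (hfs : tsupport f ⊆ Metric.ball x₀ r) (v : Plane) :
    ∫ x in Ω, fderiv ℝ f x v =
      ∫ x in frontier Ω, f x * ⟪ν x, v⟫ ∂(Measure.hausdorffMeasure 1) := by
  obtain ⟨⟨a, b⟩, rfl⟩ := L.surjective v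
  have hf0 : ∀ x, x ∉ Metric.ball x₀ r → f x = 0 := fun x hx =>
    image_eq_zero_of_notMem_tsupport fun h => hx (hfs h)
  have hf0' : ∀ x v, x ∉ Metric.ball x₀ r → fderiv ℝ f x v = 0 := fun x v hx => by
    rw [fderiv_of_notMem_tsupport ℝ fun h => hx (hfs h)]
    rfl
  rw [setIntegral_frontier_eq_graph hg hsub fun x hx => by rw [hf0 x hx, zero_mul],
    ← (measurePreserving_frame L x₀).setIntegral_preimage_emb (frame L x₀).measurableEmbedding]
  have hder : ∀ z, fderiv ℝ f (frame L x₀ z) (L ⟨a, b⟩) =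
      fderiv ℝ (f ∘ frame L x₀) z (a, b) := by
    intro z
    rw [(((hf.differentiable one_ne_zero) _).hasFDerivAt.comp z (hasFDerivAt_frame L x₀ z)).fderiv]
    rfl
  rw [setIntegral_eq_of_inter_eq (D := {z : ℝ × ℝ | z.2 < g z.1})
    (U := frame L x₀ ⁻¹' Metric.ball x₀ r) (hΩ.preimage (frame L x₀).continuous).measurableSet
    (isOpen_lt continuous_snd (hg.continuous.comp continuous_fst)).measurableSet
    (fun z hz => hf0' _ _ hz) hsub]
  simp only [hder]
  rw [setIntegral_subgraph_fderiv hg (hf.comp (contDiff_frame L x₀))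
    (hfc.comp_homeomorph (frame L x₀))]
  refine integral_congr_ae (Filter.Eventually.of_forall fun s => ?_)
  by_cases hs : frame L x₀ (s, g s) ∈ Metric.ball x₀ r
  · have hne : ‖(⟨-deriv g s, 1⟩ : ℂ)‖ ≠ 0 :=
      norm_ne_zero_iff.2 fun h0 => by simpa using congrArg Complex.im h0
    simp only [Function.comp_apply]
    rw [hν s hs, real_inner_smul_left, L.inner_map_map]
    field_simp
    simp [Complex.inner]
    ring
  · simp [hf0 _ hs]

end LocalGraph

/-! ### Gauss–Green on the whole domain. -/

theorem IsSmoothBoundedDomain.isCompact_closure {Ω : Set Plane} (hΩ : IsSmoothBoundedDomain Ω) :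
    IsCompact (closure Ω) :=
  hΩ.isBounded.isCompact_closure

theorem IsSmoothBoundedDomain.isCompact_frontier {Ω : Set Plane} (hΩ : IsSmoothBoundedDomain Ω) :
    IsCompact (frontier Ω) :=
  hΩ.isCompact_closure.of_isClosed_subset isClosed_frontier frontier_subset_closure

theorem IsSmoothBoundedDomain.hausdorffMeasure_frontier_lt_top {Ω : Set Plane}
    (hΩ : IsSmoothBoundedDomain Ω) : Measure.hausdorffMeasure 1 (frontier Ω) < ⊤ := by
  refine hΩ.isCompact_frontier.measure_lt_top_of_nhdsWithin fun x hx => ?_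
  obtain ⟨φ, hφ⟩ := hΩ.smooth_boundary x hx
  obtain ⟨L, g, hg, r, hr, hsub, -⟩ := hφ.exists_local_graph
  exact ⟨_, inter_mem_nhdsWithin _ (Metric.ball_mem_nhds x hr),
    hausdorffMeasure_frontier_inter_ball_lt_top hg hsub⟩

theorem IsSmoothBoundedDomain.integrableOn_frontier {Ω : Set Plane}
    (hΩ : IsSmoothBoundedDomain Ω) {f : Plane → ℝ} (hf : ContinuousOn f (frontier Ω)) :
    IntegrableOn f (frontier Ω) (Measure.hausdorffMeasure 1) := by
  obtain ⟨C, hC⟩ := hΩ.isCompact_frontier.exists_bound_of_continuousOn hf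
  exact IntegrableOn.of_bound hΩ.hausdorffMeasure_frontier_lt_top
    (hf.aestronglyMeasurable isClosed_frontier.measurableSet) C
    ((ae_restrict_iff' isClosed_frontier.measurableSet).2 (Filter.Eventually.of_forall hC))

theorem integral_fderiv_eq_zero_of_hasCompactSupport {f : Plane → ℝ} (hf : ContDiff ℝ 1 f)
    (hfc : HasCompactSupport f) (v : Plane) : ∫ x, fderiv ℝ f x v = 0 := by
  have h := integral_mul_fderiv_eq_neg_fderiv_mul_of_integrable (μ := (volume : Measure Plane))
    (f := fun _ : Plane => (1 : ℝ)) (g := f) (v := v) (by simp) ?_ ?_ (by simp)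
    (fun x _ => (hf.differentiable one_ne_zero) x)
  · simpa using h
  · simpa using ((hf.continuous_fderiv one_ne_zero).clm_apply
      continuous_const).integrable_of_hasCompactSupport (hfc.fderiv_apply (𝕜 := ℝ) v)
  · simpa using hf.continuous.integrable_of_hasCompactSupport hfc

open scoped RealInnerProductSpace in
theorem IsSmoothBoundedDomain.exists_local_gauss_green {Ω : Set Plane}
    (hΩ : IsSmoothBoundedDomain Ω)
    {ν : Plane → Plane} (hν : ∀ x ∈ frontier Ω, IsOutwardUnitNormalAt Ω x (ν x))
    {x₀ : Plane} (hx₀ : x₀ ∈ closure Ω) :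
    ∃ r > 0, ∀ f : Plane → ℝ, ContDiff ℝ 1 f → HasCompactSupport f →
      tsupport f ⊆ Metric.ball x₀ r → ∀ v, ∫ x in Ω, fderiv ℝ f x v =
      ∫ x in frontier Ω, f x * ⟪ν x, v⟫ ∂(Measure.hausdorffMeasure 1) := by
  by_cases hx : x₀ ∈ Ω
  · obtain ⟨r, hr, hball⟩ := Metric.isOpen_iff.1 hΩ.isOpen x₀ hx
    refine ⟨r, hr, fun f hf hfc hfs v => ?_⟩
    have h1 : ∫ x in frontier Ω, f x * ⟪ν x, v⟫ ∂(Measure.hausdorffMeasure 1) = 0 := by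
      refine setIntegral_eq_zero_of_forall_eq_zero fun x hxf => ?_
      rw [hΩ.isOpen.frontier_eq] at hxf
      rw [image_eq_zero_of_notMem_tsupport (f := f) fun h => hxf.2 (hball (hfs h)), zero_mul]
    rw [h1, setIntegral_eq_integral_of_forall_compl_eq_zero,
      integral_fderiv_eq_zero_of_hasCompactSupport hf hfc]
    intro x hxΩ
    rw [fderiv_of_notMem_tsupport ℝ fun h => hxΩ (hball (hfs h))]
    rfl
  · have hxf : x₀ ∈ frontier Ω := by
      rw [hΩ.isOpen.frontier_eq]
      exact ⟨hx₀, hx⟩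
    obtain ⟨φ, hφ⟩ := hΩ.smooth_boundary x₀ hxf
    obtain ⟨L, g, hg, r, hr, hsub, hnorm⟩ := hφ.exists_local_graph
    refine ⟨r, hr, fun f hf hfc hfs v =>
      setIntegral_fderiv_eq_of_local_graph hΩ.isOpen hg hsub (fun s hs => ?_) hf hfc hfs v⟩
    exact (hν _ ((frame_mem_frontier_iff hg hsub hs).2 rfl)).unique (hnorm s hs)

open scoped RealInnerProductSpace in
/-- The Gauss–Green formula in a smooth bounded plane domain. -/
theorem IsSmoothBoundedDomain.gauss_green {Ω : Set Plane} (hΩ : IsSmoothBoundedDomain Ω)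
    {ν : Plane → Plane} (hν : ∀ x ∈ frontier Ω, IsOutwardUnitNormalAt Ω x (ν x))
    {f : Plane → ℝ} (hf : ∀ x ∈ closure Ω, ContDiffAt ℝ 1 f x) (v : Plane) :
    ∫ x in Ω, fderiv ℝ f x v =
      ∫ x in frontier Ω, f x * ⟪ν x, v⟫ ∂(Measure.hausdorffMeasure 1) := by
  set W := {x | ContDiffAt ℝ 1 f x} with hW
  have hWo : IsOpen W := isOpen_iff_mem_nhds.2 fun x hx => ContDiffAt.eventually hx (by simp)
  have hΩW : closure Ω ⊆ W := hf
  have key : ∀ x ∈ closure Ω, ∃ β : ContDiffBump x, ∀ h : Plane → ℝ,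
      (∀ y ∈ W, ContDiffAt ℝ 1 h y) → ∫ x in Ω, fderiv ℝ (fun y => β y * h y) x v =
        ∫ x in frontier Ω, (β x * h x) * ⟪ν x, v⟫ ∂(Measure.hausdorffMeasure 1) := by
    intro x hx
    obtain ⟨r, hr, hloc⟩ := hΩ.exists_local_gauss_green hν hx
    obtain ⟨R, hR, hRW⟩ := Metric.isOpen_iff.1 hWo x (hΩW hx)
    have hm : 0 < min r R := lt_min hr hR
    let β : ContDiffBump x := ⟨min r R / 4, min r R / 2, by positivity, by linarith⟩
    have hball : Metric.closedBall x β.rOut ⊆ Metric.ball x (min r R) :=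
      Metric.closedBall_subset_ball (by show min r R / 2 < _; linarith)
    refine ⟨β, fun h hh => hloc _ (β.contDiff_mul_of_contDiffAt fun y hy => hh y ?_) ?_ ?_ v⟩
    · exact hRW (Metric.ball_subset_ball (min_le_right _ _) (hball hy))
    · exact β.hasCompactSupport.mul_right
    · refine (tsupport_mul_subset_left).trans ?_
      rw [β.tsupport_eq]
      exact hball.trans (Metric.ball_subset_ball (min_le_left _ _))
  choose! β hβ using key
  have hνc := continuousOn_outwardUnitNormal hΩ.isOpen hν
  have hintΩ : ∀ h : Plane → ℝ, (∀ y ∈ W, ContDiffAt ℝ 1 h y) →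
      IntegrableOn (fun x => fderiv ℝ h x v) Ω := by
    intro h hh
    refine (ContinuousOn.integrableOn_compact (K := closure Ω) hΩ.isCompact_closure
      fun x hx => ?_).mono_set subset_closure
    have : ContinuousAt (fderiv ℝ h) x :=
      ((hh x (hΩW hx)).fderiv_right (m := 0) (by simp)).continuousAt
    exact (this.clm_apply continuousAt_const).continuousWithinAt
  have hint : ∀ h : Plane → ℝ, (∀ y ∈ W, ContDiffAt ℝ 1 h y) →
      IntegrableOn (fun x => h x * ⟪ν x, v⟫) (frontier Ω) (Measure.hausdorffMeasure 1) := by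
    intro h hh
    refine hΩ.integrableOn_frontier (ContinuousOn.mul (fun x hx => ?_)
      (hνc.inner continuousOn_const))
    exact (hh x (hΩW (frontier_subset_closure hx))).continuousAt.continuousWithinAt
  -- Instead of a partition of unity, one bump is peeled off at a time: `h = β a * h + (1 - β a) *
  -- h`. The first summand is covered by the local formula, and the second vanishes on the ball
  -- around `a`, so one ball fewer is needed.
  have main : ∀ T : Finset Plane, (∀ x ∈ T, x ∈ closure Ω) → ∀ h : Plane → ℝ,
      (∀ y ∈ W, ContDiffAt ℝ 1 h y) →
      (∀ y ∈ closure Ω, (∀ x ∈ T, y ∉ Metric.ball x (β x).rIn) → h y = 0) →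
      ∫ x in Ω, fderiv ℝ h x v =
        ∫ x in frontier Ω, h x * ⟪ν x, v⟫ ∂(Measure.hausdorffMeasure 1) := by
    classical
    intro T
    induction T using Finset.induction_on with
    | empty =>
      intro _ h hh h0
      have h1 : ∫ x in frontier Ω, h x * ⟪ν x, v⟫ ∂(Measure.hausdorffMeasure 1) = 0 := by
        refine setIntegral_eq_zero_of_forall_eq_zero fun x hxf => ?_
        rw [h0 x (frontier_subset_closure hxf) (by simp), zero_mul]
      rw [h1]
      refine setIntegral_eq_zero_of_forall_eq_zero fun x hx => ?_
      have : h =ᶠ[nhds x] fun _ => 0 := by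
        filter_upwards [hΩ.isOpen.mem_nhds hx] with y hy using h0 y (subset_closure hy) (by simp)
      rw [this.fderiv_eq]
      simp
    | insert a T ha ih =>
      intro hT h hh h0
      have hβh : ∀ y ∈ W, ContDiffAt ℝ 1 (fun y => β a y * h y) y := fun y hy =>
        (β a).contDiff.contDiffAt.mul (hh y hy)
      have hβh' : ∀ y ∈ W, ContDiffAt ℝ 1 (fun y => (1 - β a y) * h y) y := fun y hy =>
        (contDiffAt_const.sub (β a).contDiff.contDiffAt).mul (hh y hy)
      have e1 := hβ a (hT a (by simp)) h hh
      have e2 := ih (fun x hx => hT x (by simp [hx])) (fun y => (1 - β a y) * h y) hβh' (by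
        intro y hy hyT
        by_cases hya : y ∈ Metric.ball a (β a).rIn
        · rw [(β a).one_of_mem_closedBall (Metric.ball_subset_closedBall hya)]
          simp
        · rw [h0 y hy, mul_zero]
          intro x hx
          rcases Finset.mem_insert.1 hx with rfl | hx
          · exact hya
          · exact hyT x hx)
      have e3 : ∫ x in Ω, fderiv ℝ h x v = ∫ x in Ω, (fderiv ℝ (fun y => β a y * h y) x v +
          fderiv ℝ (fun y => (1 - β a y) * h y) x v) := by
        refine setIntegral_congr_fun hΩ.isOpen.measurableSet fun x hx => ?_
        have hxW := hΩW (subset_closure hx)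
        rw [← add_apply, ← fderiv_add
          ((hβh x hxW).differentiableAt one_ne_zero) ((hβh' x hxW).differentiableAt one_ne_zero)]
        congr 2
        ext y
        simp only [Pi.add_apply]
        ring
      rw [e3, integral_add (hintΩ _ hβh) (hintΩ _ hβh'), e1, e2,
        ← integral_add (hint _ hβh) (hint _ hβh')]
      congr 1
      ext x
      ring
  obtain ⟨T, hT, hcover⟩ := hΩ.isCompact_closure.elim_nhds_subcover
    (fun x => Metric.ball x (β x).rIn) fun x _ => Metric.ball_mem_nhds x (β x).rIn_pos
  refine main T hT f (fun y hy => hy) fun y hy hyT => ?_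
  obtain ⟨x, hx, hxy⟩ := Set.mem_iUnion₂.1 (hcover hy)
  exact absurd hxy (hyT x hx)

/-! ### Complex form of Gauss–Green and the `∂̄`-derivative. -/

open scoped RealInnerProductSpace in
/-- The Gauss–Green formula in complex notation. -/
theorem IsSmoothBoundedDomain.gauss_green_complex {Ω : Set Plane} (hΩ : IsSmoothBoundedDomain Ω)
    {ν : Plane → Plane} (hν : ∀ x ∈ frontier Ω, IsOutwardUnitNormalAt Ω x (ν x))
    {Θ : ℂ → ℂ} (hΘ : ∀ x ∈ closure Ω, ContDiffAt ℝ 1 Θ (toComplex x)) :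
    ∫ x in frontier Ω, (Θ (toComplex x) * toComplex (ν x)).re ∂(Measure.hausdorffMeasure 1) =
      ∫ x in Ω, (fderiv ℝ Θ (toComplex x) 1 +
        Complex.I * fderiv ℝ Θ (toComplex x) Complex.I).re := by
  have hz : ContDiff ℝ 1 (toComplex : Plane → ℂ) := toComplex.toContinuousLinearEquiv.contDiff
  have hc : ∀ x ∈ closure Ω, ContDiffAt ℝ 1 (fun y => Θ (toComplex y)) x := fun x hx =>
    (hΘ x hx).comp x hz.contDiffAt
  have h1 : ∀ x ∈ closure Ω, ContDiffAt ℝ 1 (fun y => (Θ (toComplex y)).re) x := fun x hx =>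
    Complex.reCLM.contDiff.contDiffAt.comp x (hc x hx)
  have h2 : ∀ x ∈ closure Ω, ContDiffAt ℝ 1 (fun y => (Θ (toComplex y)).im) x := fun x hx =>
    Complex.imCLM.contDiff.contDiffAt.comp x (hc x hx)
  have hd : ∀ x ∈ closure Ω, HasFDerivAt (fun y => Θ (toComplex y))
      ((fderiv ℝ Θ (toComplex x)).comp
        (toComplex.toContinuousLinearEquiv : Plane →L[ℝ] ℂ)) x := fun x hx =>
    ((hΘ x hx).differentiableAt one_ne_zero).hasFDerivAt.comp x
      toComplex.toContinuousLinearEquiv.hasFDerivAt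
  have hd1 : ∀ x ∈ closure Ω, ∀ v, fderiv ℝ (fun y => (Θ (toComplex y)).re) x (toComplex.symm v)
      = (fderiv ℝ Θ (toComplex x) v).re := by
    intro x hx v
    have h : HasFDerivAt (fun y => (Θ (toComplex y)).re) _ x :=
      Complex.reCLM.hasFDerivAt.comp x (hd x hx)
    rw [h.fderiv]
    simp
  have hd2 : ∀ x ∈ closure Ω, ∀ v, fderiv ℝ (fun y => (Θ (toComplex y)).im) x (toComplex.symm v)
      = (fderiv ℝ Θ (toComplex x) v).im := by
    intro x hx v
    have h : HasFDerivAt (fun y => (Θ (toComplex y)).im) _ x :=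
      Complex.imCLM.hasFDerivAt.comp x (hd x hx)
    rw [h.fderiv]
    simp
  have g1 := hΩ.gauss_green hν h1 (toComplex.symm 1)
  have g2 := hΩ.gauss_green hν h2 (toComplex.symm Complex.I)
  have hνc := continuousOn_outwardUnitNormal hΩ.isOpen hν
  have i1 : ∀ (f : Plane → ℝ), (∀ x ∈ closure Ω, ContDiffAt ℝ 1 f x) → ∀ v,
      IntegrableOn (fun x => fderiv ℝ f x v) Ω := by
    intro f hf v
    refine (ContinuousOn.integrableOn_compact (K := closure Ω) hΩ.isCompact_closure
      fun x hx => ?_).mono_set subset_closure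
    have : ContinuousAt (fderiv ℝ f) x :=
      ((hf x hx).fderiv_right (m := 0) (by simp)).continuousAt
    exact (this.clm_apply continuousAt_const).continuousWithinAt
  have i2 : ∀ (f : Plane → ℝ), (∀ x ∈ closure Ω, ContDiffAt ℝ 1 f x) → ∀ v,
      IntegrableOn (fun x => f x * ⟪ν x, v⟫) (frontier Ω) (Measure.hausdorffMeasure 1) := by
    intro f hf v
    refine hΩ.integrableOn_frontier (ContinuousOn.mul (fun x hx => ?_)
      (hνc.inner continuousOn_const))
    exact (hf x (frontier_subset_closure hx)).continuousAt.continuousWithinAt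
  have hin : ∀ w : Plane, ∀ v : ℂ, ⟪w, toComplex.symm v⟫ = (starRingEnd ℂ (toComplex w) * v).re := by
    intro w v
    rw [← toComplex.inner_map_map, LinearIsometryEquiv.apply_symm_apply, Complex.inner,
      mul_comm]
  -- The vector field corresponding to `Θ` is `(Re Θ, -Im Θ)`, whose divergence is `Re (2 ∂̄Θ)`.
  have e1 : ∀ x, (Θ (toComplex x) * toComplex (ν x)).re =
      (Θ (toComplex x)).re * ⟪ν x, toComplex.symm 1⟫ -
      (Θ (toComplex x)).im * ⟪ν x, toComplex.symm Complex.I⟫ := by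
    intro x
    rw [hin, hin]
    simp
  simp only [e1]
  rw [integral_sub (i2 _ h1 _) (i2 _ h2 _), ← g1, ← g2, ← integral_sub (i1 _ h1 _) (i1 _ h2 _)]
  refine setIntegral_congr_fun hΩ.isOpen.measurableSet fun x hx => ?_
  rw [hd1 x (subset_closure hx), hd2 x (subset_closure hx)]
  simp
  ring

/-- The `∂̄`-derivative read off from the derivatives along lines. -/
theorem fderiv_one_add_I_mul_fderiv_I {Θ : ℂ → ℂ} {z A B : ℂ} (hΘ : DifferentiableAt ℝ Θ z)
    (h : ∀ v : ℂ, HasDerivAt (fun t : ℝ => Θ (z + t * v)) (A * v + B * starRingEnd ℂ v) 0) :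
    fderiv ℝ Θ z 1 + Complex.I * fderiv ℝ Θ z Complex.I = 2 * B := by
  have key : ∀ v : ℂ, fderiv ℝ Θ z v = A * v + B * starRingEnd ℂ v := by
    intro v
    have h1 : HasDerivAt (fun t : ℝ => z + t * v) v 0 := by
      simpa using (((hasDerivAt_id (0 : ℝ)).ofReal_comp).mul_const v).const_add z
    have h2 : HasFDerivAt Θ (fderiv ℝ Θ z) (z + (0 : ℝ) * v) := by
      simpa using hΘ.hasFDerivAt
    exact (h2.comp_hasDerivAt (0 : ℝ) h1).unique (h v)
  rw [key, key]
  simp only [map_one, Complex.conj_I]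
  linear_combination (A - B) * Complex.I_mul_I

theorem hasDerivAt_comp_line {F : ℂ → ℂ} {F' z : ℂ} (h : HasDerivAt F F' z) (v : ℂ) :
    HasDerivAt (fun t : ℝ => F (z + t * v)) (F' * v) 0 := by
  have h1 : HasDerivAt (fun t : ℝ => z + t * v) v 0 := by
    simpa using (((hasDerivAt_id (0 : ℝ)).ofReal_comp).mul_const v).const_add z
  have h2 : HasDerivAt F F' (z + (0 : ℝ) * v) := by simpa using h
  exact h2.comp (0 : ℝ) h1

theorem hasDerivAt_conj_comp_line {F : ℂ → ℂ} {F' z : ℂ} (h : HasDerivAt F F' z) (v : ℂ) :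
    HasDerivAt (fun t : ℝ => starRingEnd ℂ (F (z + t * v)))
      (starRingEnd ℂ F' * starRingEnd ℂ v) 0 := by
  simpa using (hasDerivAt_comp_line h v).star

/-- The real part of Cauchy's theorem: `∂̄G = 0`, so the area integral vanishes. -/
theorem IsSmoothBoundedDomain.integral_frontier_eq_zero_of_analyticAt {Ω : Set Plane}
    (hΩ : IsSmoothBoundedDomain Ω)
    {ν : Plane → Plane} (hν : ∀ x ∈ frontier Ω, IsOutwardUnitNormalAt Ω x (ν x))
    {G : ℂ → ℂ} (hG : ∀ x ∈ closure Ω, AnalyticAt ℂ G (toComplex x)) :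
    ∫ x in frontier Ω, (G (toComplex x) * toComplex (ν x)).re ∂(Measure.hausdorffMeasure 1) = 0 := by
  have hc : ∀ x ∈ closure Ω, ContDiffAt ℝ 1 G (toComplex x) := fun x hx =>
    (hG x hx).contDiffAt.restrict_scalars ℝ
  rw [hΩ.gauss_green_complex hν hc]
  refine setIntegral_eq_zero_of_forall_eq_zero fun x hx => ?_
  rw [fderiv_one_add_I_mul_fderiv_I (A := deriv G (toComplex x)) (B := 0)
    ((hc x (subset_closure hx)).differentiableAt one_ne_zero)]
  · simp
  · intro v
    simpa using hasDerivAt_comp_line (hG x (subset_closure hx)).differentiableAt.hasDerivAt v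

/-! ### The argument principle as an inequality. -/

theorem norm_sq_add_ne_zero {ε : ℝ} (hε : 0 < ε) (w : ℂ) : w * starRingEnd ℂ w + ε ≠ 0 := by
  rw [Complex.mul_conj, ← Complex.ofReal_add, Complex.ofReal_ne_zero]
  have := Complex.normSq_nonneg w
  positivity

/-- The logarithmic derivative of an analytic function, regularized at its zeros. -/
noncomputable def regLogDeriv (F : ℂ → ℂ) (ε : ℝ) (z : ℂ) : ℂ :=
  starRingEnd ℂ (F z) * deriv F z / (F z * starRingEnd ℂ (F z) + ε)

/-- The regularization is smooth even at zeros of `F`, so no discs have to be removed, and its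
`∂̄`-derivative is `ε |F'|² / (|F|² + ε)² ≥ 0`. -/
theorem IsSmoothBoundedDomain.integral_frontier_regLogDeriv_nonneg {Ω : Set Plane}
    (hΩ : IsSmoothBoundedDomain Ω)
    {ν : Plane → Plane} (hν : ∀ x ∈ frontier Ω, IsOutwardUnitNormalAt Ω x (ν x))
    {F : ℂ → ℂ} (hF : ∀ x ∈ closure Ω, AnalyticAt ℂ F (toComplex x)) {ε : ℝ} (hε : 0 < ε) :
    0 ≤ ∫ x in frontier Ω, (regLogDeriv F ε (toComplex x) * toComplex (ν x)).re
      ∂(Measure.hausdorffMeasure 1) := by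
  have hc : ∀ x ∈ closure Ω, ContDiffAt ℝ 1 (regLogDeriv F ε) (toComplex x) := by
    intro x hx
    have h1 : ContDiffAt ℝ 1 F (toComplex x) := (hF x hx).contDiffAt.restrict_scalars ℝ
    have h2 : ContDiffAt ℝ 1 (deriv F) (toComplex x) :=
      (hF x hx).deriv.contDiffAt.restrict_scalars ℝ
    have h3 : ContDiffAt ℝ 1 (fun z => starRingEnd ℂ (F z)) (toComplex x) :=
      Complex.conjCLE.contDiff.contDiffAt.comp _ h1
    exact (h3.mul h2).mul (((h1.mul h3).add contDiffAt_const).inv (norm_sq_add_ne_zero hε _))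
  rw [hΩ.gauss_green_complex hν hc]
  refine setIntegral_nonneg hΩ.isOpen.measurableSet fun x hx => ?_
  have hx' := subset_closure hx
  set z := toComplex x with hz
  have d1 := (hF x hx').differentiableAt.hasDerivAt
  have d2 := (hF x hx').deriv.differentiableAt.hasDerivAt
  rw [← hz] at d1 d2
  set a := F z with ha
  set a' := deriv F z with ha'
  set a'' := deriv (deriv F) z with ha''
  set D := a * starRingEnd ℂ a + ε with hD
  have hD0 : D ≠ 0 := norm_sq_add_ne_zero hε _
  rw [fderiv_one_add_I_mul_fderiv_I
    (A := starRingEnd ℂ a * a'' / D - starRingEnd ℂ a ^ 2 * a' ^ 2 / D ^ 2)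
    (B := ε * (a' * starRingEnd ℂ a') / D ^ 2)
    ((hc x hx').differentiableAt one_ne_zero)]
  · have hDr : D = ((Complex.normSq a + ε : ℝ) : ℂ) := by
      rw [hD, Complex.mul_conj]
      push_cast
      rfl
    have : 2 * (ε * (a' * starRingEnd ℂ a') / D ^ 2) =
        ((2 * (ε * Complex.normSq a' / (Complex.normSq a + ε) ^ 2) : ℝ) : ℂ) := by
      rw [hDr, Complex.mul_conj]
      push_cast
      rfl
    rw [this, Complex.ofReal_re]
    have := Complex.normSq_nonneg a'
    positivity
  · intro v
    have l1 := hasDerivAt_comp_line d1 v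
    have l2 := hasDerivAt_comp_line d2 v
    have l3 := hasDerivAt_conj_comp_line d1 v
    have l4 := (l3.mul l2).div ((l1.mul l3).add_const (ε : ℂ)) (by
      simpa using norm_sq_add_ne_zero hε _)
    have hval : ∀ G : ℂ → ℂ, G (z + (0 : ℝ) * v) = G z := fun G => by simp
    refine HasDerivAt.congr_deriv (f := fun t : ℝ => regLogDeriv F ε (z + t * v)) l4 ?_
    simp only [Pi.mul_apply]
    rw [hval F, hval (deriv F), ← ha, ← ha', ← hD]
    field_simp
    rw [hD]
    ring

open Topology Filter in
/-- The argument principle as an inequality: an analytic function has nonnegatively many zeros. -/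
theorem IsSmoothBoundedDomain.integral_frontier_logDeriv_nonneg {Ω : Set Plane}
    (hΩ : IsSmoothBoundedDomain Ω)
    {ν : Plane → Plane} (hν : ∀ x ∈ frontier Ω, IsOutwardUnitNormalAt Ω x (ν x))
    {F : ℂ → ℂ} (hF : ∀ x ∈ closure Ω, AnalyticAt ℂ F (toComplex x))
    (hF0 : ∀ x ∈ frontier Ω, F (toComplex x) ≠ 0) :
    0 ≤ ∫ x in frontier Ω, (logDeriv F (toComplex x) * toComplex (ν x)).re
      ∂(Measure.hausdorffMeasure 1) := by
  have hνc := continuousOn_outwardUnitNormal hΩ.isOpen hν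
  have hzν : ContinuousOn (fun x => toComplex (ν x)) (frontier Ω) :=
    toComplex.continuous.comp_continuousOn hνc
  have cF : ContinuousOn (fun x => F (toComplex x)) (frontier Ω) := fun x hx =>
    ((hF x (frontier_subset_closure hx)).continuousAt.comp
      toComplex.continuous.continuousAt).continuousWithinAt
  have cF' : ContinuousOn (fun x => deriv F (toComplex x)) (frontier Ω) := fun x hx =>
    (((hF x (frontier_subset_closure hx)).deriv).continuousAt.comp
      toComplex.continuous.continuousAt).continuousWithinAt
  have ccF : ContinuousOn (fun x => starRingEnd ℂ (F (toComplex x))) (frontier Ω) :=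
    Complex.continuous_conj.comp_continuousOn cF
  have hms : MeasurableSet (frontier Ω) := isClosed_frontier.measurableSet
  have hlim : Tendsto (fun ε : ℝ => ∫ x in frontier Ω,
      (regLogDeriv F ε (toComplex x) * toComplex (ν x)).re ∂(Measure.hausdorffMeasure 1))
      (𝓝[>] 0) (𝓝 (∫ x in frontier Ω, (logDeriv F (toComplex x) * toComplex (ν x)).re
      ∂(Measure.hausdorffMeasure 1))) := by
    -- The bound `|F'| / |F|` is continuous on the boundary, where `F` has no zeros, and dominates
    -- for every `ε > 0`.
    refine tendsto_integral_filter_of_dominated_convergence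
      (fun x => ‖deriv F (toComplex x)‖ / ‖F (toComplex x)‖) ?_ ?_ ?_ ?_
    · filter_upwards [self_mem_nhdsWithin] with ε hε
      refine ContinuousOn.aestronglyMeasurable ?_ hms
      refine Complex.continuous_re.comp_continuousOn (ContinuousOn.mul ?_ hzν)
      exact (ccF.mul cF').div ((cF.mul ccF).add continuousOn_const)
        fun x _ => norm_sq_add_ne_zero hε _
    · filter_upwards [self_mem_nhdsWithin] with ε hε
      refine (ae_restrict_iff' hms).2 (Eventually.of_forall fun x hx => ?_)
      have hε : 0 < ε := hε
      have hpos : 0 < ‖F (toComplex x)‖ := norm_pos_iff.2 (hF0 x hx)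
      refine (Complex.abs_re_le_norm _).trans ?_
      rw [norm_mul, toComplex.norm_map, (hν x hx).norm_eq_one, mul_one, regLogDeriv, norm_div,
        norm_mul, Complex.norm_conj, Complex.mul_conj, ← Complex.ofReal_add, Complex.norm_real,
        Complex.normSq_eq_norm_sq, Real.norm_of_nonneg (by positivity),
        div_le_div_iff₀ (by positivity) hpos]
      nlinarith [mul_nonneg (norm_nonneg (deriv F (toComplex x))) hε.le]
    · refine hΩ.integrableOn_frontier (cF'.norm.div cF.norm fun x hx => ?_)
      exact norm_ne_zero_iff.2 (hF0 x hx)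
    · refine (ae_restrict_iff' hms).2 (Eventually.of_forall fun x hx => ?_)
      have h1 : ContinuousAt (fun ε : ℝ => (regLogDeriv F ε (toComplex x) *
          toComplex (ν x)).re) 0 := by
        refine Complex.continuous_re.continuousAt.comp (ContinuousAt.mul ?_ continuousAt_const)
        refine continuousAt_const.div
          (continuousAt_const.add Complex.continuous_ofReal.continuousAt) ?_
        simpa using hF0 x hx
      have h2 : regLogDeriv F 0 (toComplex x) = logDeriv F (toComplex x) := by
        have := hF0 x hx
        have h3 : starRingEnd ℂ (F (toComplex x)) ≠ 0 := by simpa using this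
        rw [regLogDeriv, logDeriv_apply, Complex.ofReal_zero, add_zero]
        field_simp
      have h3 := h1.tendsto.mono_left (nhdsWithin_le_nhds (s := Set.Ioi 0))
      rwa [h2] at h3
  refine ge_of_tendsto hlim ?_
  filter_upwards [self_mem_nhdsWithin] with ε hε
    using hΩ.integral_frontier_regLogDeriv_nonneg hν hF hε

/-! ### The flux of a simple pole. -/

/-- In polar coordinates the radial integrand `2 r σ'(r²)` is the derivative of `σ(r²)`, which rises
from 0 to 1. The integrand on the left will be the divergence of a smoothed pole. -/
theorem integral_deriv_comp_norm_sq {σ : ℝ → ℝ} (hσ : ContDiff ℝ 1 σ) (hmono : Monotone σ)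
    (h0 : σ 0 = 0) {c : ℝ} (hc : ∀ t, c ≤ t → σ t = 1) :
    ∫ x : Plane, 2 * deriv σ (‖x‖ ^ 2) = 2 * Real.pi := by
  rw [integral_fun_norm_addHaar volume fun y : ℝ => 2 * deriv σ (y ^ 2)]
  have h1 : ∀ r : ℝ, HasDerivAt (fun r => σ (r ^ 2)) (r * (2 * deriv σ (r ^ 2))) r := by
    intro r
    have := (hσ.differentiable one_ne_zero (r ^ 2)).hasDerivAt.comp r (hasDerivAt_pow 2 r)
    refine this.congr_deriv ?_
    push_cast
    ring
  have h2 := integral_Ioi_of_hasDerivAt_of_nonneg' (a := (0 : ℝ)) (l := 1) (fun r _ => h1 r)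
    (fun r hr => mul_nonneg (le_of_lt hr) (mul_nonneg zero_le_two hmono.deriv_nonneg)) (by
      refine tendsto_const_nhds.congr' ?_
      filter_upwards [(Filter.tendsto_pow_atTop two_ne_zero).eventually_ge_atTop c] with r hr
      exact (hc _ hr).symm)
  have h3 : (volume : Measure Plane).real (Metric.ball 0 1) = Real.pi := by
    simp [Measure.real, Real.pi_nonneg]
  simp only [finrank_euclideanSpace_fin, Nat.add_one_sub_one, pow_one, smul_eq_mul, nsmul_eq_mul]
  rw [h2, h3]
  simp [h0]

open Topology in
/-- The flux of the gradient of `log |x - s|` through the boundary. -/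
theorem IsSmoothBoundedDomain.integral_frontier_inv_sub {Ω : Set Plane}
    (hΩ : IsSmoothBoundedDomain Ω)
    {ν : Plane → Plane} (hν : ∀ x ∈ frontier Ω, IsOutwardUnitNormalAt Ω x (ν x))
    {s : Plane} (hs : s ∈ Ω) :
    ∫ x in frontier Ω, ((toComplex x - toComplex s)⁻¹ * toComplex (ν x)).re
      ∂(Measure.hausdorffMeasure 1) = 2 * Real.pi := by
  obtain ⟨ρ, hρ, hball⟩ := Metric.isOpen_iff.1 hΩ.isOpen s hs
  have hcpos : 0 < ρ ^ 2 / 2 := by positivity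
  have hclt : ρ ^ 2 / 2 < ρ ^ 2 := by linarith
  set c := ρ ^ 2 / 2 with hc
  clear_value c
  -- The argument `2t/c - 1` is at most 0 for `t ≤ c/2` and at least 1 for `t ≥ c`. Because `c <
  -- ρ²`, the cut-off `σ(|x - s|²)` is identically 1 near every point outside `Ω`.
  set σ : ℝ → ℝ := fun t => Real.smoothTransition (2 * t / c - 1) with hσdef
  have hσ : ContDiff ℝ 1 σ :=
    (Real.smoothTransition.contDiff (n := 1)).comp (by fun_prop)
  have hmono : Monotone σ := fun a b hab => Real.smoothTransition.monotone (by gcongr)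
  have hzero : ∀ t, t ≤ c / 2 → σ t = 0 := fun t ht =>
    Real.smoothTransition.zero_of_nonpos (by rw [sub_nonpos, div_le_one hcpos]; linarith)
  have hone : ∀ t, c ≤ t → σ t = 1 := fun t ht =>
    Real.smoothTransition.one_of_one_le (by rw [le_sub_iff_add_le, le_div_iff₀ hcpos]; linarith)
  have hout : ∀ x, x ∉ Ω → ρ ^ 2 ≤ ‖x - s‖ ^ 2 := by
    intro x hx
    have : ρ ≤ ‖x - s‖ := by
      rw [← dist_eq_norm]
      by_contra! hlt
      exact hx (hball hlt)
    gcongr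
  set a := toComplex s with ha
  -- Smoothed pole: zero near `a` and equal to `1 / (ζ - a)` on the boundary. As `∂̄ |w|² = w`
  -- cancels the pole, `2 ∂̄Θ = 2 σ'(|w|²)` with `w = ζ - a`.
  set Θ : ℂ → ℂ := fun ζ => (σ (Complex.normSq (ζ - a)) : ℂ) * (ζ - a)⁻¹ with hΘ
  have hns : ContDiff ℝ 1 fun ζ : ℂ => Complex.normSq (ζ - a) := by
    simp only [Complex.normSq_eq_norm_sq]
    exact (contDiff_id.sub contDiff_const).norm_sq ℝ
  have hΘ0 : Θ =ᶠ[𝓝 a] fun _ => 0 := by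
    have : ∀ᶠ ζ in 𝓝 a, Complex.normSq (ζ - a) < c / 2 := by
      refine hns.continuous.continuousAt.eventually (gt_mem_nhds ?_)
      simpa using hcpos
    filter_upwards [this] with ζ hζ
    simp [hΘ, hzero _ hζ.le]
  have hΘc : ∀ ζ, ContDiffAt ℝ 1 Θ ζ := by
    intro ζ
    by_cases hζ : ζ = a
    · rw [hζ]
      exact contDiffAt_const.congr_of_eventuallyEq hΘ0
    · refine ContDiffAt.mul (Complex.ofRealCLM.contDiff.comp (hσ.comp hns)).contDiffAt ?_
      exact (contDiffAt_id.sub contDiffAt_const).inv (sub_ne_zero.2 hζ)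
  have hnorm : ∀ x, Complex.normSq (toComplex x - a) = ‖x - s‖ ^ 2 := fun x => by
    rw [ha, ← map_sub, Complex.normSq_eq_norm_sq, toComplex.norm_map]
  have hdbar : ∀ ζ, fderiv ℝ Θ ζ 1 + Complex.I * fderiv ℝ Θ ζ Complex.I =
      ((2 * deriv σ (Complex.normSq (ζ - a)) : ℝ) : ℂ) := by
    intro ζ
    by_cases hζ : ζ = a
    · have h1 : deriv σ 0 = 0 := by
        have : σ =ᶠ[𝓝 0] fun _ => 0 := by
          filter_upwards [gt_mem_nhds (half_pos hcpos)] with t ht using hzero t ht.le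
        rw [this.deriv_eq, deriv_const]
      rw [hζ, hΘ0.fderiv_eq]
      simp [h1]
    · have hw : ζ - a ≠ 0 := sub_ne_zero.2 hζ
      set w := ζ - a with hwdef
      rw [fderiv_one_add_I_mul_fderiv_I
        (A := ((deriv σ (Complex.normSq w) : ℝ) : ℂ) * starRingEnd ℂ w / w - σ (Complex.normSq w) / w ^ 2)
        (B := ((deriv σ (Complex.normSq w) : ℝ) : ℂ)) ((hΘc ζ).differentiableAt one_ne_zero)]
      · push_cast
        rfl
      · intro v
        have d0 : HasDerivAt (fun ζ : ℂ => ζ - a) 1 ζ := (hasDerivAt_id ζ).sub_const a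
        have e : ζ + (0 : ℝ) * v - a = w := by simp [hwdef]
        have l1 := hasDerivAt_comp_line d0 v
        have l2 := hasDerivAt_conj_comp_line d0 v
        have l3 : HasDerivAt (fun t : ℝ => Complex.normSq (ζ + t * v - a))
            (v * starRingEnd ℂ w + w * starRingEnd ℂ v).re 0 := by
          have h := Complex.reCLM.hasFDerivAt.comp_hasDerivAt (0 : ℝ) (l1.mul l2)
          have hfun : (fun t : ℝ => Complex.normSq (ζ + t * v - a)) = Complex.reCLM ∘
              ((fun t : ℝ => ζ + t * v - a) * fun t : ℝ => starRingEnd ℂ (ζ + t * v - a)) := by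
            funext t
            rw [Function.comp_apply, Pi.mul_apply, Complex.mul_conj, Complex.reCLM_apply,
              Complex.ofReal_re]
          rw [hfun]
          refine h.congr_deriv ?_
          rw [e, Complex.reCLM_apply, map_one, one_mul, one_mul]
        have hreal : (((v * starRingEnd ℂ w + w * starRingEnd ℂ v).re : ℝ) : ℂ) =
            v * starRingEnd ℂ w + w * starRingEnd ℂ v := by
          apply Complex.ext <;> simp
          ring
        have l4 : HasDerivAt (fun t : ℝ => ((σ (Complex.normSq (ζ + t * v - a)) : ℝ) : ℂ))
            (((deriv σ (Complex.normSq w) : ℝ) : ℂ) * (v * starRingEnd ℂ w + w * starRingEnd ℂ v)) 0 := by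
          have h0 : HasDerivAt σ (deriv σ (Complex.normSq w))
              (Complex.normSq (ζ + (0 : ℝ) * v - a)) := by
            rw [e]
            exact (hσ.differentiable one_ne_zero _).hasDerivAt
          have := (h0.comp (0 : ℝ) l3).ofReal_comp
          rw [Complex.ofReal_mul, hreal] at this
          exact this
        have hw0 : ζ + (0 : ℝ) * v - a ≠ 0 := by simpa using hw
        have l5 := l4.mul (l1.inv hw0)
        refine HasDerivAt.congr_deriv (f := fun t : ℝ => Θ (ζ + t * v)) l5 ?_
        simp only [e, Pi.inv_apply]
        field_simp
        ring
  have hgg := hΩ.gauss_green_complex hν fun x _ => hΘc (toComplex x)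
  simp only [hdbar, Complex.ofReal_re, hnorm] at hgg
  have e1 : ∫ x in frontier Ω, (Θ (toComplex x) * toComplex (ν x)).re
      ∂(Measure.hausdorffMeasure 1) = ∫ x in frontier Ω,
        ((toComplex x - a)⁻¹ * toComplex (ν x)).re ∂(Measure.hausdorffMeasure 1) := by
    refine setIntegral_congr_fun isClosed_frontier.measurableSet fun x hx => ?_
    rw [hΩ.isOpen.frontier_eq] at hx
    have := hone (Complex.normSq (toComplex x - a)) (by
      rw [hnorm]
      exact hclt.le.trans (hout x hx.2))
    simp only [hΘ, this]
    simp
  rw [← e1, hgg, setIntegral_eq_integral_of_forall_compl_eq_zero]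
  · rw [integral_sub_right_eq_self (fun x : Plane => 2 * deriv σ (‖x‖ ^ 2)) s]
    exact integral_deriv_comp_norm_sq hσ hmono (hzero 0 (half_pos hcpos).le) hone
  · intro x hx
    have : σ =ᶠ[𝓝 (‖x - s‖ ^ 2)] fun _ => 1 := by
      filter_upwards [lt_mem_nhds (hclt.trans_le (hout x hx))] with t ht using hone t ht.le
    rw [this.deriv_eq, deriv_const, mul_zero]

/-! ### Clearing the poles. -/

section PolarParts

variable {ι : Type*}

/-- A function with finitely many prescribed polar parts `B j / (z - a j) ^ k j`. -/
noncomputable def addPolarParts (f₀ : ℂ → ℂ) (S : Finset ι) (a : ι → ℂ) (k : ι → ℕ) (B : ι → ℂ)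
    (z : ℂ) : ℂ :=
  f₀ z + ∑ j ∈ S, B j * ((z - a j) ^ k j)⁻¹

variable {f₀ : ℂ → ℂ} {S : Finset ι} {a : ι → ℂ} {k : ι → ℕ} {B : ι → ℂ}

theorem analyticAt_addPolarParts {z : ℂ} (hf₀ : AnalyticAt ℂ f₀ z) (hz : ∀ j ∈ S, z ≠ a j) :
    AnalyticAt ℂ (addPolarParts f₀ S a k B) z := by
  refine hf₀.add (Finset.analyticAt_fun_sum S fun j hj => analyticAt_const.mul ?_)
  exact ((analyticAt_id.sub analyticAt_const).pow _).inv
    (pow_ne_zero _ (sub_ne_zero.2 (hz j hj)))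

theorem analyticAt_prod_sub_pow (T : Finset ι) (z : ℂ) :
    AnalyticAt ℂ (fun z => ∏ j ∈ T, (z - a j) ^ k j) z :=
  Finset.analyticAt_fun_prod T fun _ _ => (analyticAt_id.sub analyticAt_const).pow _

variable [DecidableEq ι]

/-- The function `addPolarParts f₀ S a k B` multiplied by `∏ (z - a j) ^ k j`. -/
noncomputable def clearedPolarParts (f₀ : ℂ → ℂ) (S : Finset ι) (a : ι → ℂ) (k : ι → ℕ)
    (B : ι → ℂ) (z : ℂ) : ℂ :=
  f₀ z * ∏ j ∈ S, (z - a j) ^ k j + ∑ j ∈ S, B j * ∏ i ∈ S.erase j, (z - a i) ^ k i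

theorem clearedPolarParts_eq {z : ℂ} (hz : ∀ j ∈ S, z ≠ a j) :
    clearedPolarParts f₀ S a k B z =
      addPolarParts f₀ S a k B z * ∏ j ∈ S, (z - a j) ^ k j := by
  rw [clearedPolarParts, addPolarParts, add_mul, Finset.sum_mul]
  congr 1
  refine Finset.sum_congr rfl fun j hj => ?_
  rw [← Finset.mul_prod_erase S _ hj]
  have := pow_ne_zero (k j) (sub_ne_zero.2 (hz j hj))
  field_simp

/-- All other terms contain the vanishing factor belonging to `j`. For distinct poles and nonzero
coefficients, clearing therefore creates no zero at a pole. -/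
theorem clearedPolarParts_apply_pole {j : ι} (hj : j ∈ S) (hk : k j ≠ 0) :
    clearedPolarParts f₀ S a k B (a j) = B j * ∏ i ∈ S.erase j, (a j - a i) ^ k i := by
  have h0 : (a j - a j) ^ k j = 0 := by rw [sub_self, zero_pow hk]
  rw [clearedPolarParts, Finset.prod_eq_zero hj h0, mul_zero, zero_add,
    Finset.sum_eq_single_of_mem j hj]
  intro i _ hij
  rw [Finset.prod_eq_zero (Finset.mem_erase.2 ⟨hij.symm, hj⟩) h0, mul_zero]

theorem analyticAt_clearedPolarParts {z : ℂ} (hf₀ : AnalyticAt ℂ f₀ z) :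
    AnalyticAt ℂ (clearedPolarParts f₀ S a k B) z :=
  (hf₀.mul (analyticAt_prod_sub_pow S z)).add
    (Finset.analyticAt_fun_sum S fun _ _ => analyticAt_const.mul (analyticAt_prod_sub_pow _ z))

open Topology in
theorem logDeriv_clearedPolarParts {z : ℂ} (hf₀ : AnalyticAt ℂ f₀ z) (hz : ∀ j ∈ S, z ≠ a j)
    (hne : addPolarParts f₀ S a k B z ≠ 0) :
    logDeriv (clearedPolarParts f₀ S a k B) z =
      logDeriv (addPolarParts f₀ S a k B) z + ∑ j ∈ S, (k j : ℂ) * (z - a j)⁻¹ := by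
  have hev : clearedPolarParts f₀ S a k B =ᶠ[𝓝 z]
      fun z => addPolarParts f₀ S a k B z * ∏ j ∈ S, (z - a j) ^ k j := by
    have : ∀ᶠ w in 𝓝 z, ∀ j ∈ S, w ≠ a j :=
      (Finset.eventually_all S).2 fun j hj => eventually_ne_nhds (hz j hj)
    filter_upwards [this] with w hw using clearedPolarParts_eq hw
  have hne' : ∀ j ∈ S, (z - a j) ^ k j ≠ 0 := fun j hj =>
    pow_ne_zero _ (sub_ne_zero.2 (hz j hj))
  have hd : ∀ j, DifferentiableAt ℂ (fun z => (z - a j) ^ k j) z := fun j => by fun_prop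
  rw [logDeriv_apply, hev.deriv_eq, hev.eq_of_nhds, ← logDeriv_apply,
    logDeriv_mul z hne (Finset.prod_ne_zero_iff.2 hne')
      (analyticAt_addPolarParts hf₀ hz).differentiableAt
      (analyticAt_prod_sub_pow S z).differentiableAt,
    logDeriv_prod hne' fun j _ => hd j]
  congr 1
  refine Finset.sum_congr rfl fun j hj => ?_
  rw [logDeriv_fun_pow (by fun_prop), logDeriv_apply]
  simp

variable {Ω : Set Plane} {ν : Plane → Plane} {s : ι → Plane}

/-- The argument principle for a function with prescribed polar parts, in integrated form. -/
theorem IsSmoothBoundedDomain.integral_frontier_logDeriv_addPolarParts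
    (hΩ : IsSmoothBoundedDomain Ω) (hν : ∀ x ∈ frontier Ω, IsOutwardUnitNormalAt Ω x (ν x))
    (hs : ∀ j ∈ S, s j ∈ Ω) (hf₀ : ∀ x ∈ closure Ω, AnalyticAt ℂ f₀ (toComplex x))
    (hne : ∀ x ∈ frontier Ω,
      addPolarParts f₀ S (fun j => toComplex (s j)) k B (toComplex x) ≠ 0) :
    IntegrableOn (fun x => (logDeriv (addPolarParts f₀ S (fun j => toComplex (s j)) k B)
      (toComplex x) * toComplex (ν x)).re) (frontier Ω) (Measure.hausdorffMeasure 1) ∧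
    ∫ x in frontier Ω, (logDeriv (clearedPolarParts f₀ S (fun j => toComplex (s j)) k B)
      (toComplex x) * toComplex (ν x)).re ∂(Measure.hausdorffMeasure 1) =
    ∫ x in frontier Ω, (logDeriv (addPolarParts f₀ S (fun j => toComplex (s j)) k B)
      (toComplex x) * toComplex (ν x)).re ∂(Measure.hausdorffMeasure 1) +
      2 * Real.pi * ∑ j ∈ S, (k j : ℝ) := by
  have hzν : ContinuousOn (fun x => toComplex (ν x)) (frontier Ω) :=
    toComplex.continuous.comp_continuousOn (continuousOn_outwardUnitNormal hΩ.isOpen hν)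
  have hout : ∀ x ∈ frontier Ω, ∀ j ∈ S, toComplex x ≠ toComplex (s j) := by
    intro x hx j hj h
    rw [hΩ.isOpen.frontier_eq] at hx
    exact hx.2 (toComplex.injective h ▸ hs j hj)
  have hint1 : IntegrableOn (fun x => (logDeriv (addPolarParts f₀ S
      (fun j => toComplex (s j)) k B) (toComplex x) * toComplex (ν x)).re)
      (frontier Ω) (Measure.hausdorffMeasure 1) := by
    refine hΩ.integrableOn_frontier (Complex.continuous_re.comp_continuousOn
      (ContinuousOn.mul (fun x hx => ?_) hzν))
    have han := analyticAt_addPolarParts (k := k) (B := B)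
      (hf₀ x (frontier_subset_closure hx)) (hout x hx)
    exact ((han.deriv.continuousAt.div han.continuousAt (hne x hx)).comp
      toComplex.continuous.continuousAt).continuousWithinAt
  have hint2 : ∀ j ∈ S, IntegrableOn (fun x => (k j : ℝ) *
      ((toComplex x - toComplex (s j))⁻¹ * toComplex (ν x)).re)
      (frontier Ω) (Measure.hausdorffMeasure 1) := by
    intro j hj
    refine (hΩ.integrableOn_frontier (Complex.continuous_re.comp_continuousOn
      (ContinuousOn.mul (fun x hx => ?_) hzν))).const_mul _
    exact ((toComplex.continuous.continuousAt.sub continuousAt_const).inv₀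
      (sub_ne_zero.2 (hout x hx j hj))).continuousWithinAt
  refine ⟨hint1, ?_⟩
  have h1 : ∀ x ∈ frontier Ω, (logDeriv (clearedPolarParts f₀ S (fun j => toComplex (s j)) k B)
      (toComplex x) * toComplex (ν x)).re =
      (logDeriv (addPolarParts f₀ S (fun j => toComplex (s j)) k B)
      (toComplex x) * toComplex (ν x)).re + ∑ j ∈ S, (k j : ℝ) *
      ((toComplex x - toComplex (s j))⁻¹ * toComplex (ν x)).re := by
    intro x hx
    rw [logDeriv_clearedPolarParts (hf₀ x (frontier_subset_closure hx)) (hout x hx) (hne x hx),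
      add_mul, Complex.add_re, Finset.sum_mul, Complex.re_sum]
    congr 1
    refine Finset.sum_congr rfl fun j _ => ?_
    rw [mul_assoc, ← Complex.ofReal_natCast, Complex.re_ofReal_mul]
  rw [setIntegral_congr_fun isClosed_frontier.measurableSet h1,
    integral_add hint1 (integrable_finsetSum S hint2), integral_finsetSum S hint2,
    Finset.mul_sum]
  congr 1
  refine Finset.sum_congr rfl fun j hj => ?_
  rw [integral_const_mul, hΩ.integral_frontier_inv_sub hν (hs j hj), mul_comm]

/-- Coinciding points and zero coefficients are harmless: they can only give the cleared function
extra zeros inside, and the inequality for analytic functions permits any zeros there. -/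
theorem IsSmoothBoundedDomain.integral_frontier_logDeriv_addPolarParts_ge
    (hΩ : IsSmoothBoundedDomain Ω) (hν : ∀ x ∈ frontier Ω, IsOutwardUnitNormalAt Ω x (ν x))
    (hs : ∀ j ∈ S, s j ∈ Ω) (hf₀ : ∀ x ∈ closure Ω, AnalyticAt ℂ f₀ (toComplex x))
    (hne : ∀ x ∈ frontier Ω,
      addPolarParts f₀ S (fun j => toComplex (s j)) k B (toComplex x) ≠ 0) :
    -(2 * Real.pi * ∑ j ∈ S, (k j : ℝ)) ≤
    ∫ x in frontier Ω, (logDeriv (addPolarParts f₀ S (fun j => toComplex (s j)) k B)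
      (toComplex x) * toComplex (ν x)).re ∂(Measure.hausdorffMeasure 1) := by
  have h1 := (hΩ.integral_frontier_logDeriv_addPolarParts hν hs hf₀ hne).2
  have h2 := hΩ.integral_frontier_logDeriv_nonneg hν
    (F := clearedPolarParts f₀ S (fun j => toComplex (s j)) k B)
    (fun x hx => analyticAt_clearedPolarParts (hf₀ x hx)) fun x hx => ?_
  · linarith
  · have hout : ∀ j ∈ S, toComplex x ≠ toComplex (s j) := by
      intro j hj h
      rw [hΩ.isOpen.frontier_eq] at hx
      exact hx.2 (toComplex.injective h ▸ hs j hj)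
    rw [clearedPolarParts_eq hout]
    exact mul_ne_zero (hne x hx) (Finset.prod_ne_zero_iff.2 fun j hj =>
      pow_ne_zero _ (sub_ne_zero.2 (hout j hj)))

/-- The hypotheses make the cleared function zero-free on the closure, both at the poles and away
from them, so its logarithmic derivative is analytic and has no flux. -/
theorem IsSmoothBoundedDomain.integral_frontier_logDeriv_addPolarParts_eq
    (hΩ : IsSmoothBoundedDomain Ω) (hν : ∀ x ∈ frontier Ω, IsOutwardUnitNormalAt Ω x (ν x))
    (hs : ∀ j ∈ S, s j ∈ Ω) (hf₀ : ∀ x ∈ closure Ω, AnalyticAt ℂ f₀ (toComplex x))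
    (hB : ∀ j ∈ S, B j ≠ 0) (hk : ∀ j ∈ S, k j ≠ 0) (hinj : Set.InjOn s S)
    (hne : ∀ x ∈ closure Ω, (∀ j ∈ S, x ≠ s j) →
      addPolarParts f₀ S (fun j => toComplex (s j)) k B (toComplex x) ≠ 0) :
    ∫ x in frontier Ω, (logDeriv (addPolarParts f₀ S (fun j => toComplex (s j)) k B)
      (toComplex x) * toComplex (ν x)).re ∂(Measure.hausdorffMeasure 1) =
      -(2 * Real.pi * ∑ j ∈ S, (k j : ℝ)) := by
  have hout : ∀ x ∈ frontier Ω, ∀ j ∈ S, x ≠ s j := by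
    rintro x hx j hj rfl
    rw [hΩ.isOpen.frontier_eq] at hx
    exact hx.2 (hs j hj)
  have h1 := (hΩ.integral_frontier_logDeriv_addPolarParts hν hs hf₀
    fun x hx => hne x (frontier_subset_closure hx) (hout x hx)).2
  have hF : ∀ x ∈ closure Ω,
      clearedPolarParts f₀ S (fun j => toComplex (s j)) k B (toComplex x) ≠ 0 := by
    intro x hx
    by_cases hxs : ∀ j ∈ S, x ≠ s j
    · have hxs' : ∀ j ∈ S, toComplex x ≠ toComplex (s j) := fun j hj h =>
        hxs j hj (toComplex.injective h)
      rw [clearedPolarParts_eq hxs']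
      exact mul_ne_zero (hne x hx hxs) (Finset.prod_ne_zero_iff.2 fun j hj =>
        pow_ne_zero _ (sub_ne_zero.2 (hxs' j hj)))
    · push Not at hxs
      obtain ⟨j, hj, rfl⟩ := hxs
      rw [clearedPolarParts_apply_pole (a := fun j => toComplex (s j)) hj (hk j hj)]
      refine mul_ne_zero (hB j hj) (Finset.prod_ne_zero_iff.2 fun i hi => pow_ne_zero _ ?_)
      rw [Finset.mem_erase] at hi
      exact sub_ne_zero.2 fun h => hi.1 (hinj hi.2 hj (toComplex.injective h).symm)
  have h2 := hΩ.integral_frontier_eq_zero_of_analyticAt hν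
    (G := logDeriv (clearedPolarParts f₀ S (fun j => toComplex (s j)) k B)) fun x hx =>
    (analyticAt_clearedPolarParts (hf₀ x hx)).deriv.div
      (analyticAt_clearedPolarParts (hf₀ x hx)) (hF x hx)
  linarith

end PolarParts

/-! ### The complex gradient of the potential. -/

/-- The real linear form `v ↦ Re (w v)`, where `v` is read as a complex number. -/
noncomputable def reMulForm (w : ℂ) : Plane →L[ℝ] ℝ :=
  Complex.reCLM.comp ((ContinuousLinearMap.mul ℝ ℂ w).comp
    (toComplex.toContinuousLinearEquiv : Plane →L[ℝ] ℂ))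

@[simp]
theorem reMulForm_apply (w : ℂ) (v : Plane) : reMulForm w v = (w * toComplex v).re := rfl

theorem reMulForm_add (w w' : ℂ) : reMulForm (w + w') = reMulForm w + reMulForm w' := by
  ext v
  simp [add_mul]

theorem reMulForm_real_mul (r : ℝ) (w : ℂ) : reMulForm (r * w) = r • reMulForm w := by
  ext v
  simp [mul_assoc]

theorem reMulForm_sum {ι : Type*} (S : Finset ι) (w : ι → ℂ) :
    reMulForm (∑ j ∈ S, w j) = ∑ j ∈ S, reMulForm (w j) := by
  ext v
  simp [Finset.sum_mul]

theorem norm_gradient_of_hasFDerivAt {u : Plane → ℝ} {x : Plane} {w : ℂ}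
    (h : HasFDerivAt u (reMulForm w) x) : ‖gradient u x‖ = ‖w‖ := by
  have : gradient u x = toComplex.symm (starRingEnd ℂ w) := by
    refine ext_inner_right ℝ fun v => ?_
    rw [inner_gradient_left, h.fderiv, reMulForm_apply, ← toComplex.inner_map_map,
      LinearIsometryEquiv.apply_symm_apply, Complex.inner, Complex.conj_conj, mul_comm]
  rw [this, LinearIsometryEquiv.norm_map, Complex.norm_conj]

/-- The complex number (`1` or `I`) corresponding to a coordinate vector of the plane. -/
noncomputable def coordUnit (i : Fin 2) : ℂ := toComplex (EuclideanSpace.single i 1)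

theorem coordUnit_ne_zero (i : Fin 2) : coordUnit i ≠ 0 := by
  rw [coordUnit, Ne, LinearIsometryEquiv.map_eq_zero_iff, ← norm_eq_zero]
  simp

/-- `f` has the complex gradient `c / z ^ n` away from the origin. -/
def HasPowerGradient (f : Plane → ℝ) (c : ℂ) (n : ℕ) : Prop :=
  ∀ x : Plane, x ≠ 0 → HasFDerivAt f (reMulForm (c * (toComplex x ^ n)⁻¹)) x

theorem hasPowerGradient_fundSol : HasPowerGradient fundSol (1 / (2 * Real.pi)) 1 := by
  intro x hx
  have hxn : ‖x‖ ^ 2 ≠ 0 := by simpa using hx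
  have hx' : toComplex x ≠ 0 := by simpa using hx
  have h1 : fundSol = fun x => (1 / (4 * Real.pi)) * Real.log (‖x‖ ^ 2) := by
    ext y
    rw [fundSol, Real.log_pow]
    push_cast
    field_simp
    ring
  rw [h1]
  have h2 := ((hasStrictFDerivAt_norm_sq x).hasFDerivAt.log hxn).const_mul (1 / (4 * Real.pi))
  refine h2.congr_fderiv ?_
  ext v
  have h3 : inner ℝ x v = (starRingEnd ℂ (toComplex x) * toComplex v).re := by
    rw [← toComplex.inner_map_map, Complex.inner, mul_comm]
  have h4 : (toComplex x)⁻¹ = ((‖x‖ ^ 2)⁻¹ : ℝ) * starRingEnd ℂ (toComplex x) := by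
    rw [Complex.inv_def, Complex.normSq_eq_norm_sq, toComplex.norm_map, mul_comm]
  have h5 : (1 / (2 * Real.pi) * (toComplex x ^ 1)⁻¹ * toComplex v : ℂ) =
      ((1 / (2 * Real.pi) * (‖x‖ ^ 2)⁻¹ : ℝ) : ℂ) *
        (starRingEnd ℂ (toComplex x) * toComplex v) := by
    rw [pow_one, h4]
    push_cast
    ring
  rw [reMulForm_apply, h5, Complex.re_ofReal_mul, ← h3]
  simp
  field_simp
  norm_num

-- Away from the origin the partial derivative is the real part of the holomorphic function `c e
-- z⁻ⁿ`, with `e` the coordinate unit; differentiating that function yields the next power.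
open Topology in
theorem HasPowerGradient.partialDeriv {f : Plane → ℝ} {c : ℂ} {n : ℕ} (h : HasPowerGradient f c n)
    (i : Fin 2) : HasPowerGradient (partialDeriv i f) (-n * coordUnit i * c) (n + 1) := by
  intro x hx
  have hx' : toComplex x ≠ 0 := by simpa using hx
  have hev : _root_.partialDeriv i f =ᶠ[𝓝 x]
      fun y => (c * (toComplex y ^ n)⁻¹ * coordUnit i).re := by
    filter_upwards [eventually_ne_nhds hx] with y hy
    rw [_root_.partialDeriv, (h y hy).fderiv, reMulForm_apply, coordUnit]
  refine HasFDerivAt.congr_of_eventuallyEq ?_ hev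
  have hd : HasDerivAt (fun z : ℂ => c * (z ^ n)⁻¹ * coordUnit i)
      (-n * coordUnit i * c * (toComplex x ^ (n + 1))⁻¹) (toComplex x) := by
    have := (((hasDerivAt_pow n (toComplex x)).inv (pow_ne_zero n hx')).const_mul c).mul_const
      (coordUnit i)
    refine this.congr_deriv ?_
    rcases n with _ | n
    · simp
    · simp only [Nat.add_sub_cancel]
      field_simp
      ring
  have h1 := Complex.reCLM.hasFDerivAt.comp x ((hd.hasFDerivAt.restrictScalars ℝ).comp x
    toComplex.toContinuousLinearEquiv.hasFDerivAt)
  refine h1.congr_fderiv ?_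
  ext v
  simp
  ring_nf

/-- The exponent has the form `n + 1` because each derivative multiplies the constant by minus the
exponent, which must not vanish. -/
theorem HasPowerGradient.exists_iterate_partialDeriv (i : Fin 2) (m : ℕ) {f : Plane → ℝ} {c : ℂ}
    {n : ℕ} (hc : c ≠ 0) (h : HasPowerGradient f c (n + 1)) :
    ∃ c' ≠ 0, HasPowerGradient ((_root_.partialDeriv i)^[m] f) c' (m + n + 1) := by
  induction m with
  | zero => exact ⟨c, hc, by simpa using h⟩
  | succ m ih =>
    obtain ⟨c', hc', h'⟩ := ih
    rw [Function.iterate_succ_apply']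
    have h2 := h'.partialDeriv i
    rw [show m + n + 1 + 1 = m + 1 + n + 1 by ring] at h2
    refine ⟨_, ?_, h2⟩
    refine mul_ne_zero (mul_ne_zero (neg_ne_zero.2 ?_) (coordUnit_ne_zero i)) hc'
    exact_mod_cast (Nat.succ_ne_zero (m + n))

theorem exists_hasPowerGradient_multiDeriv_fundSol (α : Fin 2 → ℕ) :
    ∃ c ≠ 0, HasPowerGradient (multiDeriv α fundSol) c (multiOrder α + 1) := by
  have h0 : (1 / (2 * Real.pi) : ℂ) ≠ 0 := by simp [Real.pi_ne_zero]
  obtain ⟨c, hc, h⟩ := hasPowerGradient_fundSol.exists_iterate_partialDeriv (n := 0) 1 (α 1) h0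
  obtain ⟨c', hc', h'⟩ := h.exists_iterate_partialDeriv 0 (α 0) hc
  exact ⟨c', hc', by simpa [multiOrder, multiDeriv] using h'⟩

-- The Laplacian can be computed in any orthonormal basis, and an isometry carries one such basis to
-- another.
open InnerProductSpace in
theorem HarmonicAt.comp_linearIsometryEquiv {E F : Type*} [NormedAddCommGroup E]
    [InnerProductSpace ℝ E] [FiniteDimensional ℝ E] [NormedAddCommGroup F] [InnerProductSpace ℝ F]
    [FiniteDimensional ℝ F] {f : F → ℝ} (L : E ≃ₗᵢ[ℝ] F) {x : E} (h : HarmonicAt f (L x)) :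
    HarmonicAt (f ∘ L) x := by
  refine ⟨h.1.comp x L.toContinuousLinearEquiv.contDiff.contDiffAt, ?_⟩
  filter_upwards [L.continuous.continuousAt.eventually h.2] with y hy
  have hL : Laplacian.laplacian (f ∘ L) y = Laplacian.laplacian f (L y) := by
    rw [laplacian_eq_iteratedFDeriv_orthonormalBasis _ (stdOrthonormalBasis ℝ E),
      laplacian_eq_iteratedFDeriv_orthonormalBasis _ ((stdOrthonormalBasis ℝ E).map L)]
    refine Finset.sum_congr rfl fun i _ => ?_
    have h2 : iteratedFDeriv ℝ 2 (f ∘ L) y =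
        (iteratedFDeriv ℝ 2 f (L y)).compContinuousLinearMap
          fun _ => (L.toContinuousLinearEquiv : E →L[ℝ] F) := by
      have h3 := L.toContinuousLinearEquiv.iteratedFDerivWithin_comp_right f uniqueDiffOn_univ
        (Set.mem_univ (L y)) 2
      simp only [Set.preimage_univ, iteratedFDerivWithin_univ] at h3
      exact h3
    rw [h2, ContinuousMultilinearMap.compContinuousLinearMap_apply]
    congr 1
    funext j
    fin_cases j <;> simp
  rw [hL]
  exact hy

-- The function is `∂₁u - i ∂₂u`, which is globally defined, so no harmonic conjugate and no simple
-- connectivity is needed. The differential is given on a neighbourhood because `|Du|²` will be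
-- differentiated.
open InnerProductSpace in
theorem InnerProductSpace.HarmonicOnNhd.exists_analyticAt_complex_gradient {u : Plane → ℝ}
    {K : Set Plane} (h : HarmonicOnNhd u K) :
    ∃ f : ℂ → ℂ, ∀ x ∈ K, AnalyticAt ℂ f (toComplex x) ∧
      ∀ᶠ y in nhds x, HasFDerivAt u (reMulForm (f (toComplex y))) y := by
  set U : ℂ → ℝ := u ∘ toComplex.symm with hU
  refine ⟨fun z => fderiv ℝ U z 1 - Complex.I * fderiv ℝ U z Complex.I, fun x hx => ⟨?_, ?_⟩⟩
  · refine HarmonicAt.analyticAt_complex_partial (HarmonicAt.comp_linearIsometryEquiv _ ?_)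
    simpa using h x hx
  · filter_upwards [(h x hx).eventually] with y hy
    have hd : HasFDerivAt u (fderiv ℝ u y) (toComplex.symm (toComplex y)) := by
      simpa using (hy.1.differentiableAt two_ne_zero).hasFDerivAt
    have hUd : HasFDerivAt U ((fderiv ℝ u y).comp
        (toComplex.symm.toContinuousLinearEquiv : ℂ →L[ℝ] Plane)) (toComplex y) :=
      hd.comp (toComplex y) toComplex.symm.toContinuousLinearEquiv.hasFDerivAt
    refine (hy.1.differentiableAt two_ne_zero).hasFDerivAt.congr_fderiv ?_
    ext v
    rw [reMulForm_apply, hUd.fderiv]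
    have hv : v = (toComplex v).re • toComplex.symm 1 +
        (toComplex v).im • toComplex.symm Complex.I := by
      apply toComplex.injective
      apply Complex.ext <;> simp
    conv_lhs => rw [hv]
    simp
    ring

open Topology in
/-- The normal derivative of `|Du|²` in terms of the logarithmic derivative of the complex
gradient. -/
theorem fderiv_normSq_comp_div {p : Plane → ℝ} {f : ℂ → ℂ} {x : Plane}
    (hf : AnalyticAt ℂ f (toComplex x)) (hne : f (toComplex x) ≠ 0)
    (hp : ∀ᶠ y in 𝓝 x, p y = ‖f (toComplex y)‖ ^ 2) (n : Plane) :
    fderiv ℝ p x n / (2 * p x) = (logDeriv f (toComplex x) * toComplex n).re := by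
  have hp' : p =ᶠ[𝓝 x] fun y => ‖f (toComplex y)‖ ^ 2 := hp
  have hd : HasFDerivAt (fun y : Plane => f (toComplex y)) _ x :=
    (hf.differentiableAt.hasDerivAt.hasFDerivAt.restrictScalars ℝ).comp x
      toComplex.toContinuousLinearEquiv.hasFDerivAt
  rw [hp'.fderiv_eq, hp'.eq_of_nhds, (hd.norm_sq).fderiv, logDeriv_apply, div_mul_eq_mul_div]
  have hn : ‖f (toComplex x)‖ ≠ 0 := norm_ne_zero_iff.2 hne
  have h1 : deriv f (toComplex x) * toComplex n / f (toComplex x) =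
      (((‖f (toComplex x)‖ ^ 2)⁻¹ : ℝ) : ℂ) *
        (deriv f (toComplex x) * toComplex n * starRingEnd ℂ (f (toComplex x))) := by
    rw [div_eq_mul_inv, Complex.inv_def, Complex.normSq_eq_norm_sq]
    ring
  rw [h1, Complex.re_ofReal_mul]
  simp [Complex.inner]
  field_simp
  ring

/-! ### The main theorem. -/

theorem theorem1
    (Ω : Set Plane) (hΩ : IsSmoothBoundedDomain Ω)
    -- the outward unit normal field on the boundary
    (ν : Plane → Plane) (hν : ∀ x ∈ frontier Ω, IsOutwardUnitNormalAt Ω x (ν x))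
    -- the sources: their numbers, moments and locations
    (N : ℕ) (Nα : (Fin 2 → ℕ) → ℕ)
    (b : (α : Fin 2 → ℕ) → Fin (Nα α) → ℝ)
    (s : (α : Fin 2 → ℕ) → Fin (Nα α) → Plane)
    (hs : ∀ α ∈ multiIndices N, ∀ j, s α j ∈ Ω)
    -- the potential
    (u₀ : Plane → ℝ) (hu₀ : InnerProductSpace.HarmonicOnNhd u₀ (closure Ω))
    (u : Plane → ℝ)
    (hu : ∀ x, u x = u₀ x +
      ∑ α ∈ multiIndices N, ∑ j, b α j * multiDeriv α fundSol (x - s α j))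
    -- the data
    (p : Plane → ℝ) (hp : ∀ x, p x = ‖gradient u x‖ ^ 2)
    (q : Plane → ℝ) (hq : ∀ x, q x = fderiv ℝ p x (ν x))
    (hpos : ∀ x ∈ frontier Ω, 0 < p x) :
    IntegrableOn (fun x => q x / (2 * p x)) (frontier Ω) (Measure.hausdorffMeasure 1) ∧
    -(1 / (2 * Real.pi)) *
        ∫ x in frontier Ω, q x / (2 * p x) ∂(Measure.hausdorffMeasure 1)
      ≤ ∑ α ∈ multiIndices N, ((multiOrder α : ℝ) + 1) * (Nα α : ℝ) ∧
    -- equality for genuine sources at pairwise distinct points, if `p` has no zeros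
    ((∀ α ∈ multiIndices N, ∀ j, b α j ≠ 0) →
      (∀ α ∈ multiIndices N, ∀ β ∈ multiIndices N, ∀ (j : Fin (Nα α)) (k : Fin (Nα β)),
        s α j = s β k → α = β ∧ (j : ℕ) = (k : ℕ)) →
      (∀ x ∈ Ω, (∀ α ∈ multiIndices N, ∀ j, x ≠ s α j) → p x ≠ 0) →
      -(1 / (2 * Real.pi)) *
          ∫ x in frontier Ω, q x / (2 * p x) ∂(Measure.hausdorffMeasure 1)
        = ∑ α ∈ multiIndices N, ((multiOrder α : ℝ) + 1) * (Nα α : ℝ)) := by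
  choose c hc0 hc using exists_hasPowerGradient_multiDeriv_fundSol
  obtain ⟨f₀, hf₀⟩ := hu₀.exists_analyticAt_complex_gradient
  classical
  -- The double sum over `α` and `j` is flattened to one index set of poles, with order `k = |α| +
  -- 1` and coefficient `B`.
  set S : Finset (Σ α : Fin 2 → ℕ, Fin (Nα α)) :=
    (multiIndices N).sigma fun _ => Finset.univ with hS
  set σ : (Σ α : Fin 2 → ℕ, Fin (Nα α)) → Plane := fun j => s j.1 j.2 with hσ
  set k : (Σ α : Fin 2 → ℕ, Fin (Nα α)) → ℕ := fun j => multiOrder j.1 + 1 with hk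
  set B : (Σ α : Fin 2 → ℕ, Fin (Nα α)) → ℂ := fun j => b j.1 j.2 * c j.1 with hB
  set f := addPolarParts f₀ S (fun j => toComplex (σ j)) k B with hf
  have hsum : ∑ α ∈ multiIndices N, ((multiOrder α : ℝ) + 1) * (Nα α : ℝ) =
      ∑ j ∈ S, (k j : ℝ) := by
    rw [hS, Finset.sum_sigma]
    refine Finset.sum_congr rfl fun α _ => ?_
    simp [hk]
    ring
  have hσΩ : ∀ j ∈ S, σ j ∈ Ω := fun j hj => hs j.1 (Finset.mem_sigma.1 hj).1 j.2
  have hgrad : ∀ x ∈ closure Ω, (∀ j ∈ S, x ≠ σ j) → ∀ᶠ y in nhds x,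
      HasFDerivAt u (reMulForm (f (toComplex y))) y := by
    intro x hx hxσ
    have hev : ∀ᶠ y in nhds x, ∀ j ∈ S, y ≠ σ j :=
      (Finset.eventually_all S).2 fun j hj => eventually_ne_nhds (hxσ j hj)
    filter_upwards [(hf₀ x hx).2, hev] with y hy hyσ
    have hu' : u = fun x => u₀ x + ∑ j ∈ S, b j.1 j.2 * multiDeriv j.1 fundSol (x - σ j) := by
      ext x
      rw [hu x, hS, Finset.sum_sigma]
    have hterm : ∀ j ∈ S, HasFDerivAt (fun x => b j.1 j.2 * multiDeriv j.1 fundSol (x - σ j))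
        (reMulForm (B j * ((toComplex y - toComplex (σ j)) ^ k j)⁻¹)) y := by
      intro j hj
      have h1 : HasFDerivAt (fun x => multiDeriv j.1 fundSol (x - σ j)) _ y :=
        (hc j.1 (y - σ j) (sub_ne_zero.2 (hyσ j hj))).comp y ((hasFDerivAt_id y).sub_const (σ j))
      refine (h1.const_mul (b j.1 j.2)).congr_fderiv ?_
      rw [hB, mul_assoc, reMulForm_real_mul, map_sub]
      rfl
    rw [hu', hf, addPolarParts, reMulForm_add, reMulForm_sum]
    exact hy.add (HasFDerivAt.fun_sum hterm)
  have hpf : ∀ x ∈ closure Ω, (∀ j ∈ S, x ≠ σ j) → ∀ᶠ y in nhds x,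
      p y = ‖f (toComplex y)‖ ^ 2 := by
    intro x hx hxσ
    filter_upwards [hgrad x hx hxσ] with y hy
    rw [hp, norm_gradient_of_hasFDerivAt hy]
  have hout : ∀ x ∈ frontier Ω, ∀ j ∈ S, x ≠ σ j := by
    rintro x hx j hj rfl
    rw [hΩ.isOpen.frontier_eq] at hx
    exact hx.2 (hσΩ j hj)
  have hne : ∀ x ∈ frontier Ω, f (toComplex x) ≠ 0 := by
    intro x hx h0
    have h1 := (hpf x (frontier_subset_closure hx) (hout x hx)).self_of_nhds
    rw [h0, norm_zero] at h1
    exact (hpos x hx).ne' (by rw [h1]; norm_num)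
  have hf₀a : ∀ x ∈ closure Ω, AnalyticAt ℂ f₀ (toComplex x) := fun x hx => (hf₀ x hx).1
  have hqp : ∀ x ∈ frontier Ω, q x / (2 * p x) =
      (logDeriv f (toComplex x) * toComplex (ν x)).re := by
    intro x hx
    rw [hq]
    refine fderiv_normSq_comp_div (analyticAt_addPolarParts
      (hf₀a x (frontier_subset_closure hx)) fun j hj h => ?_) (hne x hx)
      (hpf x (frontier_subset_closure hx) (hout x hx)) _
    exact hout x hx j hj (toComplex.injective h)
  have hmeas : MeasurableSet (frontier Ω) := isClosed_frontier.measurableSet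
  have hpi := Real.pi_pos
  rw [setIntegral_congr_fun hmeas hqp, hsum]
  refine ⟨?_, ?_, ?_⟩
  · exact (integrableOn_congr_fun hqp hmeas).2
      (hΩ.integral_frontier_logDeriv_addPolarParts hν hσΩ hf₀a hne).1
  · have h1 := hΩ.integral_frontier_logDeriv_addPolarParts_ge hν hσΩ hf₀a hne
    rw [neg_mul, neg_le, one_div, inv_mul_eq_div, le_div_iff₀ (by positivity)]
    linarith
  · intro hb hinj hp0
    have h1 := hΩ.integral_frontier_logDeriv_addPolarParts_eq (k := k) (B := B) hν hσΩ hf₀a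
      ?_ ?_ ?_ ?_
    · rw [h1]
      field_simp
    · intro j hj
      exact mul_ne_zero (Complex.ofReal_ne_zero.2 (hb j.1 (Finset.mem_sigma.1 hj).1 j.2))
        (hc0 j.1)
    · exact fun j _ => Nat.succ_ne_zero _
    · rintro ⟨α, i⟩ hi ⟨β, j⟩ hj hij
      obtain ⟨rfl, h2⟩ := hinj α (Finset.mem_sigma.1 hi).1 β (Finset.mem_sigma.1 hj).1 i j hij
      rw [Fin.ext h2]
    -- Zeros of `f` are excluded inside `Ω` by the extra hypothesis on `p`, and on the boundary by
    -- `p > 0`.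
    · intro x hx hxσ
      by_cases hxΩ : x ∈ Ω
      · intro h0
        refine hp0 x hxΩ (fun α hα j => hxσ ⟨α, j⟩ (Finset.mem_sigma.2 ⟨hα, Finset.mem_univ _⟩)) ?_
        rw [(hpf x hx hxσ).self_of_nhds, hf, h0]
        simp
      · exact hne x (by rw [hΩ.isOpen.frontier_eq]; exact ⟨hx, hxΩ⟩)
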